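/- Let $d\ge 1$ be an integer and $\nu=d/2-1$. For $n\ge 0$ let $$L_n^{(\nu)}(x)=\sum_{k=0}^n(-1)^k\binom{n+\nu}{n-k}\frac{x^k}{k!}$$ be the generalized Laguerre polynomials, which are orthogonal for the measure $e^{-x}x^\nu\,dx$ on $(0,\infty)$ with $\int_0^\infty|L_n^{(\nu)}(x)|^2e^{-x}x^\nu\,dx=\Gamma(n+\nu+1)/n!$, and put $$d\mu_\nu(x)=\frac{e^{-x}x^\nu}{\Gamma(\nu+1)}\,dx\ \ (x>0),\qquad \Psi_n(x)=L_n^{(\nu)}(2\pi\|x\|^2)\,e^{-\pi\|x\|^2}\ \ (x\in\mathbb{R}^d).$$ Let $2\le p,q<\infty$ satisfy $\frac dp+\frac2q=\frac d2$. Then for every $t\in\mathbb{R}$ there is exactly one bounded linear operator $\mathcal{L}^t$ on $L^2(\mathbb{R}_+,d\mu_\nu)$ such that $$\mathcal{L}^t:\ L_n^{(\nu)}(x)\mapsto e^{2\pi i n t}\,L_n^{(\nu)}\big(\tfrac2p\,x\big)\qquad\text{for all } n\ge 0 .$$ Let $f\in L^2(\mathbb{R}^d,dx)$ be a radial complex-valued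 function with the expansion $f=\sum_{n\ge0}\alpha(n)\Psi_n$ (convergence in $L^2$). Then the series $g=\sum_{n\ge0}\alpha(n)L_n^{(\nu)}$ converges in $L^2(\mathbb{R}_+,d\mu_\nu)$, and $$\frac{\big\|\,\|e^{it\Delta}f(x)\|_{L^p(dx)}\big\|_{L^q(dt)}}{\big(p^{-1/(2p)}\,2^{1/p-1/2}\big)^d}=\left(\int_{-1/2}^{1/2}\bigg(\int_0^\infty|\mathcal{L}^tg(x)|^p\,\frac{e^{-x}x^\nu}{\Gamma(\nu+1)}\,dx\bigg)^{q/p}dt\right)^{1/q}$$ and $$\frac{C(p,d)}{\big(p^{-1/(2p)}\,2^{1/p-1/2}\big)^d}\,\|f\|_{L^2(dx)}=\bigg(\int_0^\infty|g(x)|^2\,\frac{e^{-x}x^\nu}{\Gamma(\nu+1)}\,dx\bigg)^{1/2},\qquad C(p,d)=\big(p^{-1/(2p)}\,2^{1/p-1/4}\big)^d .$$ Here $e^{it\Delta}f$ is the solution $u(x,t)$ of $\partial_tu=i\Delta u$ with $u(x,0)=f(x)$, that is, $\widehat{e^{it\Delta}f}(\xi)=e^{-4\pi^2it\|\xi\|^2}\widehat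 f(\xi)$ with $\widehat f(\xi)=\int_{\mathbb{R}^d} f(x)e^{-2\pi i x\cdot\xi}\,dx$ (extended to $L^2$), and the first identity is an identity in $[0,\infty]$. -/

import Mathlib

open MeasureTheory Filter Topology FourierTransform

noncomputable section

/-- The generalized Laguerre polynomial
`L_n^{(ν)}(x) = ∑_{k=0}^n (-1)^k * binom(n + ν, n - k) * x^k / k!`, where
`binom(n + ν, n - k) = (ν + k + 1) ⋯ (ν + n) / (n - k)!`. -/
def laguerreL (ν : ℝ) (n : ℕ) (x : ℝ) : ℝ :=
  ∑ k ∈ Finset.range (n + 1),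
    (-1) ^ k * ((∏ j ∈ Finset.Ioc k n, (ν + (j : ℝ))) / (Nat.factorial (n - k) : ℝ)) *
      (x ^ k / (Nat.factorial k : ℝ))

/-- The measure `e^{-x} x^ν / Γ(ν + 1) dx` on the half-line `x > 0`. -/
def laguerreMeasure (ν : ℝ) : Measure ℝ :=
  (volume.restrict (Set.Ioi 0)).withDensity
    (fun x => ENNReal.ofReal (Real.exp (-x) * x ^ ν / Real.Gamma (ν + 1)))

/-- The complex Hilbert space `L²(ℝ^d, dx)`. -/
abbrev SpaceL2 (d : ℕ) : Type :=
  Lp ℂ 2 (volume : Measure (EuclideanSpace ℝ (Fin d)))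

/-- The complex Hilbert space `L²(ℝ₊, e^{-x} x^ν / Γ(ν + 1) dx)`. -/
abbrev LaguerreL2 (ν : ℝ) : Type := Lp ℂ 2 (laguerreMeasure ν)

/-- `Ψ_n(x) = L_n^{(ν)}(2π‖x‖²) e^{-π‖x‖²}` on `ℝ^d`, with `ν = d/2 - 1`. -/
def radialPsi (d n : ℕ) (x : EuclideanSpace ℝ (Fin d)) : ℝ :=
  laguerreL ((d : ℝ) / 2 - 1) n (2 * Real.pi * ‖x‖ ^ 2) * Real.exp (-Real.pi * ‖x‖ ^ 2)

/-- `f = ∑_{n ≥ 0} α(n) φ_n`, with convergence of the partial sums in `L²(μ)`. -/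
def IsL2Expansion {X : Type*} [MeasurableSpace X] (μ : Measure X)
    (φ : ℕ → X → ℝ) (α : ℕ → ℂ) (f : X → ℂ) : Prop :=
  Tendsto (fun N : ℕ =>
    eLpNorm (fun x => f x - ∑ n ∈ Finset.range N, α n * (φ n x : ℂ)) 2 μ) atTop (𝓝 0)

/-- A square-integrable function is radial if it is almost everywhere a function of `‖x‖`. -/
def IsRadial {d : ℕ} (f : SpaceL2 d) : Prop :=
  ∃ F : ℝ → ℂ, ∀ᵐ x ∂(volume : Measure (EuclideanSpace ℝ (Fin d))), f x = F ‖x‖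

/-- The Fourier symbol `e^{-4π² i t ‖ξ‖²}` of `e^{itΔ}`; here `Δ` has the symbol `-4π² ‖ξ‖²`. -/
def schrodingerSymbol {d : ℕ} (t : ℝ) (ξ : EuclideanSpace ℝ (Fin d)) : ℂ :=
  Complex.exp (((-(4 * Real.pi ^ 2 * t * ‖ξ‖ ^ 2) : ℝ) : ℂ) * Complex.I)

theorem memLp_schrodingerSymbol_mul {d : ℕ} (t : ℝ) (h : SpaceL2 d) :
    MemLp (fun ξ => schrodingerSymbol t ξ * h ξ) 2
      (volume : Measure (EuclideanSpace ℝ (Fin d))) := by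
  have hc : Continuous (schrodingerSymbol t : EuclideanSpace ℝ (Fin d) → ℂ) := by
    unfold schrodingerSymbol; fun_prop
  refine (Lp.memLp h).of_le
    (hc.aestronglyMeasurable.mul (Lp.aestronglyMeasurable h)) ?_
  refine Eventually.of_forall fun ξ => ?_
  rw [norm_mul, schrodingerSymbol, Complex.norm_exp_ofReal_mul_I, one_mul]

/-- The Schrödinger propagator on `L²(ℝ^d)`: `e^{itΔ} f` is the solution at time `t` of
`∂_t u = iΔu`, `u(0) = f`, that is, `(e^{itΔ} f)^(ξ) = e^{-4π² i t ‖ξ‖²} f^(ξ)`, with the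
unitary Fourier transform of kernel `e^{-2π i x·ξ}`. -/
def schrodinger {d : ℕ} (t : ℝ) (f : SpaceL2 d) : SpaceL2 d :=
  𝓕⁻ ((memLp_schrodingerSymbol_mul t (𝓕 f)).toLp _)

/-- The mixed norm `‖ ‖e^{itΔ} f(x)‖_{L^p(dx)} ‖_{L^q(dt)}`, with values in `[0, ∞]`. -/
def strichartzNorm {d : ℕ} (p q : ℝ) (f : SpaceL2 d) : ENNReal :=
  eLpNorm (fun t : ℝ => eLpNorm (schrodinger t f) (ENNReal.ofReal p) volume)
    (ENNReal.ofReal q) volume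

/-- The bounded operator `T` on `L²(ℝ₊, e^{-x} x^ν / Γ(ν + 1) dx)` acts on the Laguerre
polynomials by `L_n^{(ν)}(x) ↦ e^{2π i n t} L_n^{(ν)}((2/p) x)` for every `n`. -/
def IsLaguerreOperator (ν p t : ℝ) (T : LaguerreL2 ν →L[ℂ] LaguerreL2 ν) : Prop :=
  ∀ n : ℕ, ∃ u : LaguerreL2 ν,
    (∀ᵐ x ∂laguerreMeasure ν, u x = (laguerreL ν n x : ℂ)) ∧
    (∀ᵐ x ∂laguerreMeasure ν,
      T u x = Complex.exp (2 * Real.pi * Complex.I * n * t) * (laguerreL ν n (2 / p * x) : ℂ))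

/-- The normalizing factor `(p^{-1/(2p)} 2^{1/p - 1/2})^d`. -/
def normalizingFactor (p : ℝ) (d : ℕ) : ℝ :=
  (p ^ (-(1 / (2 * p))) * (2 : ℝ) ^ (1 / p - 1 / 2)) ^ d

/-- The constant `C(p, d) = (p^{-1/(2p)} 2^{1/p - 1/4})^d`. -/
def sharpConst (p : ℝ) (d : ℕ) : ℝ :=
  (p ^ (-(1 / (2 * p))) * (2 : ℝ) ^ (1 / p - 1 / 4)) ^ d

end

/-! The engine is the lens transform. With `s = 4πt`, let `W_s` send `h` to `(1+is)^{-d/2}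
e^{-π‖x‖²/(1+is)} h(2π‖x‖²/(1+s²))`. Since `‖x‖²` carries a Gaussian to a Laguerre measure
(`map_gaussian_eq_laguerreMeasure`), every `W_s` is `2^{-d/4}` times an isometry of `L²(μ_ν)` into
`L²(ℝ^d)`. The operator `J = W_0` maps `L_n` to `Ψ_n`, so the expansion of `f` pulls back to that of
`g`.

The key identity (`schrodinger_lensOperator`) is `e^{itΔ} J = W_s M`, where `M L_n = κ^n L_n` and `κ
= (1-is)/(1+is)`. Both sides are bounded, so it suffices to test it on the exponentials `e^{-σx}`,
which are total by Weierstrass approximation in the variable `e^{-x/4}`. There `J` gives Gaussians,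
whose evolution is explicit, and `M` is computed from the coefficients `⟨L_n, e^{-σx}⟩`, which are
geometric in `σ/(1+σ)`.

Moreover `κ = e^{2πiτ}` with `τ = -arctan(s)/π`, and `𝓛^τ` is `M` followed by the dilation `x ↦
2x/p`. The `p`-th power of the lens weight produces exactly this dilation, with a factor
`(1+s²)^{d/2-dp/4}`. Raised to the power `q/p`, this becomes `(1+s²)^{-1}` by the admissibility
relation. Up to a factor `4` it is the Jacobian of `t ↦ τ`, which maps `ℝ` onto `(-1/2, 1/2)`. -/

/-! ### Polar coordinates and the image of a Gaussian under `‖x‖²` -/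

theorem lintegral_fun_norm_addHaar {E : Type*} [NormedAddCommGroup E] [NormedSpace ℝ E]
    [MeasurableSpace E] [BorelSpace E] [FiniteDimensional ℝ E] [Nontrivial E]
    (μ : Measure E) [μ.IsAddHaarMeasure] {f : ℝ → ENNReal} (hf : Measurable f) :
    ∫⁻ x, f ‖x‖ ∂μ = μ.toSphere Set.univ *
      ∫⁻ r in Set.Ioi (0 : ℝ), ENNReal.ofReal (r ^ (Module.finrank ℝ E - 1)) * f r := by
  have h1 : ∫⁻ x, f ‖x‖ ∂μ = ∫⁻ x : ({(0)}ᶜ : Set E), f ‖x.1‖ ∂(μ.comap (↑)) := by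
    rw [lintegral_subtype_comap (measurableSet_singleton _).compl fun x ↦ f (‖x‖),
      MeasureTheory.restrict_compl_singleton]
  have h2 : ∫⁻ x : ({(0)}ᶜ : Set E), f ‖x.1‖ ∂(μ.comap (↑)) =
      ∫⁻ x, f x.2 ∂μ.toSphere.prod (.volumeIoiPow (Module.finrank ℝ E - 1)) := by
    simpa using μ.measurePreserving_homeomorphUnitSphereProd.lintegral_comp_emb
        (Homeomorph.measurableEmbedding _) (f ∘ Subtype.val ∘ Prod.snd)
  rw [h1, h2, lintegral_prod _ (by fun_prop)]
  simp only [lintegral_const]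
  rw [mul_comm, Measure.volumeIoiPow, lintegral_withDensity_eq_lintegral_mul _ (by fun_prop)
    (by fun_prop)]
  simp only [Pi.mul_apply]
  rw [lintegral_subtype_comap measurableSet_Ioi
    (fun r : ℝ => ENNReal.ofReal (r ^ (Module.finrank ℝ E - 1)) * f r)]

/-- Polar coordinates and the substitution `y = a r²`; the constant is the total mass of the
Gaussian. All later norm computations reduce to this formula. -/
theorem map_gaussian_eq_laguerreMeasure {d : ℕ} (hd : 1 ≤ d) {a : ℝ} (ha : 0 < a) :
    ((volume : Measure (EuclideanSpace ℝ (Fin d))).withDensity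
      (fun x => ENNReal.ofReal (Real.exp (-(a * ‖x‖ ^ 2))))).map (fun x => a * ‖x‖ ^ 2) =
    ENNReal.ofReal ((Real.pi / a) ^ ((d : ℝ) / 2)) • laguerreMeasure ((d : ℝ) / 2 - 1) := by
  have : Nonempty (Fin d) := ⟨⟨0, hd⟩⟩
  have hd' : (0 : ℝ) < d := by exact_mod_cast hd
  have hG : 0 < Real.Gamma ((d : ℝ) / 2) := Real.Gamma_pos_of_pos (by positivity)
  refine Measure.ext_of_lintegral _ fun f hf => ?_
  rw [lintegral_map hf (by fun_prop), lintegral_withDensity_eq_lintegral_mul _ (by fun_prop)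
    (by fun_prop), lintegral_smul_measure, laguerreMeasure,
    lintegral_withDensity_eq_lintegral_mul _ (by fun_prop) hf]
  simp only [Pi.mul_apply]
  rw [lintegral_fun_norm_addHaar volume
    (f := fun r => ENNReal.ofReal (Real.exp (-(a * r ^ 2))) * f (a * r ^ 2)) (by fun_prop)]
  have himg : (fun r : ℝ => a * r ^ 2) '' Set.Ioi 0 = Set.Ioi 0 := by
    ext y
    simp only [Set.mem_image, Set.mem_Ioi]
    constructor
    · rintro ⟨r, hr, rfl⟩; positivity
    · intro hy
      refine ⟨√(y / a), Real.sqrt_pos.2 (by positivity), ?_⟩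
      rw [Real.sq_sqrt (by positivity)]; field_simp
  have hsub := lintegral_image_eq_lintegral_abs_deriv_mul (f := fun r : ℝ => a * r ^ 2)
    (f' := fun r => a * (2 * r)) measurableSet_Ioi
    (fun r _ => by
      simpa using ((hasDerivAt_pow 2 r).const_mul a).hasDerivWithinAt)
    (fun r hr r' hr' h => by
      have h' : r ^ 2 = r' ^ 2 := mul_left_cancel₀ ha.ne' h
      exact (sq_eq_sq₀ (le_of_lt hr) (le_of_lt hr')).1 h')
    (fun y => ENNReal.ofReal (Real.exp (-y) * y ^ ((d : ℝ) / 2 - 1) /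
      Real.Gamma ((d : ℝ) / 2 - 1 + 1)) * f y)
  rw [himg] at hsub
  rw [hsub, Measure.toSphere_apply_univ, EuclideanSpace.volume_ball, finrank_euclideanSpace, smul_eq_mul,
    ← lintegral_const_mul _ (by fun_prop), ← lintegral_const_mul _ (by fun_prop)]
  refine setLIntegral_congr_fun measurableSet_Ioi fun r hr => ?_
  have hr : 0 < r := hr
  simp only [Fintype.card_fin, ENNReal.ofReal_one, one_pow, one_mul, sub_add_cancel]
  rw [← ENNReal.ofReal_natCast, ← mul_assoc, ← mul_assoc, ← mul_assoc, ← mul_assoc]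
  congr 1
  rw [← ENNReal.ofReal_mul (by positivity), ← ENNReal.ofReal_mul (by positivity),
    ← ENNReal.ofReal_mul (by positivity), ← ENNReal.ofReal_mul (by positivity),
    ← ENNReal.ofReal_mul (by positivity), abs_of_pos (by positivity)]
  congr 1
  -- The sphere has area `d π^{d/2} / Γ(d/2+1)`, and `Γ(d/2+1) = (d/2) Γ(d/2)` cancels the `d`.
  rw [Real.Gamma_add_one (by positivity), Real.mul_rpow ha.le (by positivity),
    ← Real.rpow_natCast r 2, ← Real.rpow_mul hr.le, ← Real.rpow_natCast r (d - 1),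
    ← Real.rpow_natCast _ d, Real.sqrt_eq_rpow, ← Real.rpow_mul Real.pi_pos.le,
    Real.div_rpow Real.pi_pos.le ha.le, Real.rpow_sub_one ha.ne']
  have e1 : r ^ (((2 : ℕ) : ℝ) * ((d : ℝ) / 2 - 1)) * r = r ^ (((d - 1 : ℕ) : ℝ)) := by
    nth_rewrite 2 [← Real.rpow_one r]
    rw [← Real.rpow_add hr]
    congr 1
    push_cast [Nat.cast_sub hd]; ring
  have e2 : (1 / 2 * (d : ℝ)) = d / 2 := by ring
  rw [← e1, e2]
  have : (0 : ℝ) < a ^ ((d : ℝ) / 2) := by positivity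
  field_simp

/-! ### Weighted composition operators between `L²` spaces -/

/-- Points where `w` vanishes do not matter, and `hC` makes the image of the remaining mass
absolutely continuous. Hence the operator is well defined on classes. -/
theorem weighted_comp_congr_ae {X Y : Type*} [MeasurableSpace X] [MeasurableSpace Y]
    {μ : Measure X} {κ : Measure Y} {φ : X → Y} (hφ : Measurable φ) {w : X → ℂ}
    (hw : Measurable w) {C : ENNReal}
    (hC : (μ.withDensity fun x => ‖w x‖ₑ ^ 2).map φ ≤ C • κ) {h h' : Y → ℂ}
    (hh : h =ᵐ[κ] h') : (fun x => w x * h (φ x)) =ᵐ[μ] fun x => w x * h' (φ x) := by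
  have h1 : h =ᵐ[(μ.withDensity fun x => ‖w x‖ₑ ^ 2).map φ] h' :=
    (Measure.absolutelyContinuous_of_le_smul hC).ae_le hh
  have h2 := ae_of_ae_map hφ.aemeasurable h1
  rw [ae_withDensity_iff (by fun_prop)] at h2
  filter_upwards [h2] with x hx
  by_cases h0 : w x = 0
  · simp [h0]
  · rw [hx (by simpa using h0)]

theorem eLpNorm_weighted_comp_le {X Y : Type*} [MeasurableSpace X] [MeasurableSpace Y]
    {μ : Measure X} {κ : Measure Y} {φ : X → Y} (hφ : Measurable φ) {w : X → ℂ}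
    (hw : Measurable w) {C : ENNReal}
    (hC : (μ.withDensity fun x => ‖w x‖ₑ ^ 2).map φ ≤ C • κ) {h : Y → ℂ}
    (hh : Measurable h) :
    eLpNorm (fun x => w x * h (φ x)) 2 μ ≤ C ^ (1 / 2 : ℝ) * eLpNorm h 2 κ := by
  rw [eLpNorm_eq_lintegral_rpow_enorm_toReal (by simp) (by simp),
    eLpNorm_eq_lintegral_rpow_enorm_toReal (by simp) (by simp)]
  simp only [ENNReal.toReal_ofNat]
  rw [← ENNReal.mul_rpow_of_nonneg _ _ (by norm_num)]
  gcongr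
  calc ∫⁻ x, ‖w x * h (φ x)‖ₑ ^ (2 : ℝ) ∂μ
      = ∫⁻ y, ‖h y‖ₑ ^ (2 : ℝ) ∂((μ.withDensity fun x => ‖w x‖ₑ ^ 2).map φ) := by
        rw [lintegral_map (by fun_prop) hφ,
          lintegral_withDensity_eq_lintegral_mul _ (by fun_prop) (by fun_prop)]
        refine lintegral_congr fun x => ?_
        simp [enorm_mul, mul_pow]
    _ ≤ ∫⁻ y, ‖h y‖ₑ ^ (2 : ℝ) ∂(C • κ) := lintegral_mono' hC le_rfl
    _ = C * ∫⁻ y, ‖h y‖ₑ ^ (2 : ℝ) ∂κ := by rw [lintegral_smul_measure, smul_eq_mul]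

/-- The common source of three operators: the Schrödinger multiplier (`φ = id`), the dilation (`w =
1`) and the lens transform. -/
theorem exists_weighted_comp {X Y : Type*} [MeasurableSpace X] [MeasurableSpace Y]
    {μ : Measure X} {κ : Measure Y} {φ : X → Y} (hφ : Measurable φ) {w : X → ℂ}
    (hw : Measurable w) {C : ENNReal} (hCtop : C ≠ ⊤)
    (hC : (μ.withDensity fun x => ‖w x‖ₑ ^ 2).map φ ≤ C • κ) :
    ∃ W : Lp ℂ 2 κ →L[ℂ] Lp ℂ 2 μ, ∀ h : Lp ℂ 2 κ, W h =ᵐ[μ] fun x => w x * h (φ x) := by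
  have hmeas (h : Lp ℂ 2 κ) : Measurable h := (Lp.stronglyMeasurable h).measurable
  have hfin : C ^ (1 / 2 : ℝ) ≠ ⊤ := ENNReal.rpow_ne_top_of_nonneg (by norm_num) hCtop
  have hmem (h : Lp ℂ 2 κ) : MemLp (fun x => w x * h (φ x)) 2 μ :=
    ⟨(hw.mul ((hmeas h).comp hφ)).aestronglyMeasurable,
      (eLpNorm_weighted_comp_le hφ hw hC (hmeas h)).trans_lt
        (ENNReal.mul_lt_top hfin.lt_top (Lp.eLpNorm_lt_top h))⟩
  let L : Lp ℂ 2 κ →ₗ[ℂ] Lp ℂ 2 μ :=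
    { toFun := fun h => (hmem h).toLp _
      map_add' := fun h h' => by
        rw [← MemLp.toLp_add]
        refine MemLp.toLp_congr _ _ ?_
        filter_upwards [weighted_comp_congr_ae hφ hw hC (Lp.coeFn_add h h')] with x hx
        rw [hx]; simp [mul_add]
      map_smul' := fun c h => by
        rw [RingHom.id_apply, ← MemLp.toLp_const_smul]
        refine MemLp.toLp_congr _ _ ?_
        filter_upwards [weighted_comp_congr_ae hφ hw hC (Lp.coeFn_smul c h)] with x hx
        rw [hx]; simp [mul_left_comm] }
  refine ⟨L.mkContinuous (C ^ (1 / 2 : ℝ)).toReal fun h => ?_, fun h => (hmem h).coeFn_toLp⟩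
  rw [show L h = (hmem h).toLp _ from rfl, Lp.norm_toLp, Lp.norm_def, ← ENNReal.toReal_mul]
  exact ENNReal.toReal_mono (ENNReal.mul_ne_top hfin (Lp.eLpNorm_ne_top h))
    (eLpNorm_weighted_comp_le hφ hw hC (hmeas h))

/-! ### The `L²` Fourier transform and the Schrödinger flow on Gaussians -/

/-- The two transforms agree as tempered distributions, into which `L²` embeds injectively. -/
theorem fourier_toLp_of_integrable {V : Type*} [NormedAddCommGroup V] [InnerProductSpace ℝ V]
    [FiniteDimensional ℝ V] [MeasurableSpace V] [BorelSpace V] {f : V → ℂ}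
    (hf : Integrable f) (hf2 : MemLp f 2) (hg : MemLp (𝓕 f) 2) :
    𝓕 (hf2.toLp f) = hg.toLp (𝓕 f) := by
  have hinj : Function.Injective (Lp.toTemperedDistributionCLM ℂ (volume : Measure V) 2) :=
    LinearMap.ker_eq_bot.1 Lp.ker_toTemperedDistributionCLM_eq_bot
  apply hinj
  simp only [Lp.toTemperedDistributionCLM_apply]
  rw [← Lp.fourier_toTemperedDistribution_eq]
  ext φ
  rw [TemperedDistribution.fourier_apply, Lp.toTemperedDistribution_apply,
    Lp.toTemperedDistribution_apply]
  have h1 : ∫ x, (𝓕 φ) x • (hf2.toLp f) x = ∫ x, (𝓕 (φ : V → ℂ)) x • f x := by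
    refine integral_congr_ae ?_
    filter_upwards [hf2.coeFn_toLp] with x hx
    rw [hx, SchwartzMap.fourier_coe]
  have h2 : ∫ x, φ x • (hg.toLp (𝓕 f)) x = ∫ x, φ x • (𝓕 f) x := by
    refine integral_congr_ae ?_
    filter_upwards [hg.coeFn_toLp] with x hx
    rw [hx]
  rw [h1, h2]
  -- The multiplication formula `∫ φ̂ f = ∫ φ f̂` for integrable functions.
  simpa using! (VectorFourier.integral_fourierIntegral_smul_eq_flip (L := innerₗ V)
      Real.continuous_fourierChar continuous_inner φ.integrable hf)

/-- The Gaussian `x ↦ e^{-πz‖x‖²}` on `ℝ^d`, with a complex parameter `z`. -/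
noncomputable def complexGaussian (d : ℕ) (z : ℂ) (x : EuclideanSpace ℝ (Fin d)) : ℂ :=
  Complex.exp (-(Real.pi * z) * ‖x‖ ^ 2)

theorem measurable_complexGaussian (d : ℕ) (z : ℂ) : Measurable (complexGaussian d z) := by
  unfold complexGaussian; fun_prop

theorem integrable_complexGaussian (d : ℕ) {z : ℂ} (hz : 0 < z.re) :
    Integrable (complexGaussian d z) := by
  have := GaussianFourier.integrable_cexp_neg_mul_sq_norm_add
    (V := EuclideanSpace ℝ (Fin d)) (b := Real.pi * z)
    (by rw [Complex.re_ofReal_mul]; positivity) 0 0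
  exact this.congr (Eventually.of_forall fun x => by simp [complexGaussian])

theorem memLp_complexGaussian (d : ℕ) {z : ℂ} (hz : 0 < z.re) :
    MemLp (complexGaussian d z) 2 := by
  rw [memLp_two_iff_integrable_sq_norm (measurable_complexGaussian d z).aestronglyMeasurable]
  refine (integrable_complexGaussian d (z := 2 * z) (by simpa using hz)).norm.congr
    (Eventually.of_forall fun x => ?_)
  simp only [complexGaussian]
  rw [← norm_pow, ← Complex.exp_nat_mul]
  congr 2; push_cast; ring

theorem fourier_complexGaussian (d : ℕ) {z : ℂ} (hz : 0 < z.re) :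
    𝓕 (complexGaussian d z) = fun ξ => (1 / z) ^ ((d : ℂ) / 2) * complexGaussian d (1 / z) ξ := by
  ext ξ
  have h := fourier_gaussian_innerProductSpace (V := EuclideanSpace ℝ (Fin d))
    (b := Real.pi * z) (by rw [Complex.re_ofReal_mul]; positivity) ξ
  have hz0 : z ≠ 0 := by rintro rfl; simp at hz
  have hpi : (Real.pi : ℂ) ≠ 0 := by exact_mod_cast Real.pi_ne_zero
  have e1 : (Real.pi : ℂ) / (Real.pi * z) = 1 / z := by field_simp
  have e2 : (-Real.pi ^ 2 * ‖ξ‖ ^ 2 / (Real.pi * z) : ℂ) = -(Real.pi * (1 / z)) * ‖ξ‖ ^ 2 := by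
    field_simp
  rw [finrank_euclideanSpace, Fintype.card_fin, e1, e2] at h
  exact h

theorem re_one_div_pos {z : ℂ} (hz : 0 < z.re) : 0 < (1 / z).re := by
  rw [one_div, Complex.inv_re]
  exact div_pos hz (Complex.normSq_pos.2 fun h => by simp [h] at hz)

theorem fourier_toLp_complexGaussian (d : ℕ) {z : ℂ} (hz : 0 < z.re) :
    𝓕 ((memLp_complexGaussian d hz).toLp _) =
      (1 / z) ^ ((d : ℂ) / 2) • (memLp_complexGaussian d (re_one_div_pos hz)).toLp _ := by
  have hg : MemLp (𝓕 (complexGaussian d z)) 2 := by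
    rw [fourier_complexGaussian d hz]
    exact (memLp_complexGaussian d (re_one_div_pos hz)).const_mul _
  rw [fourier_toLp_of_integrable (integrable_complexGaussian d hz) _ hg, ← MemLp.toLp_const_smul]
  exact MemLp.toLp_congr _ _ (Eventually.of_forall fun ξ => by
    rw [fourier_complexGaussian d hz]; rfl)

theorem measurable_schrodingerSymbol {d : ℕ} (t : ℝ) :
    Measurable (schrodingerSymbol t : EuclideanSpace ℝ (Fin d) → ℂ) := by
  unfold schrodingerSymbol; fun_prop

theorem norm_schrodingerSymbol {d : ℕ} (t : ℝ) (ξ : EuclideanSpace ℝ (Fin d)) :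
    ‖schrodingerSymbol t ξ‖ = 1 := by
  rw [schrodingerSymbol, Complex.norm_exp_ofReal_mul_I]

theorem exists_continuousLinearMap_eq_schrodinger (d : ℕ) (t : ℝ) :
    ∃ S : SpaceL2 d →L[ℂ] SpaceL2 d, ∀ f, S f = schrodinger t f := by
  obtain ⟨W, hW⟩ := exists_weighted_comp (μ := (volume : Measure (EuclideanSpace ℝ (Fin d))))
    (κ := volume) (φ := id) measurable_id (measurable_schrodingerSymbol t) (C := 1) (by simp)
    (by
      have : (fun x : EuclideanSpace ℝ (Fin d) => ‖schrodingerSymbol t x‖ₑ ^ 2) = 1 := by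
        ext x
        rw [← ofReal_norm, norm_schrodingerSymbol]; simp
      rw [this, withDensity_one, Measure.map_id, one_smul])
  let Φ := (Lp.fourierTransformₗᵢ (EuclideanSpace ℝ (Fin d)) ℂ).toContinuousLinearEquiv
  refine ⟨Φ.symm.toContinuousLinearMap ∘L W ∘L Φ.toContinuousLinearMap, fun f => ?_⟩
  have : W (𝓕 f) = (memLp_schrodingerSymbol_mul t (𝓕 f)).toLp _ := by
    apply Lp.ext
    filter_upwards [hW (𝓕 f), (memLp_schrodingerSymbol_mul t (𝓕 f)).coeFn_toLp] with x h1 h2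
    rw [h1, h2]; rfl
  rw [schrodinger, ← this]
  rfl

/-- On the Fourier side the Gaussian has parameter `1/z`, and the symbol adds `4πit` to it. The
factor `c` is fixed by an equation, so that the choice of branch for the powers is settled where the
lemma is applied. -/
theorem schrodinger_complexGaussian (d : ℕ) (t : ℝ) {z z' : ℂ} (hz : 0 < z.re) (hz' : 0 < z'.re)
    (h : 1 / z' = 1 / z + 4 * Real.pi * t * Complex.I) {c : ℂ}
    (hc : c * (1 / z') ^ ((d : ℂ) / 2) = (1 / z) ^ ((d : ℂ) / 2)) :
    schrodinger t ((memLp_complexGaussian d hz).toLp _) =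
      c • (memLp_complexGaussian d hz').toLp _ := by
  rw [schrodinger]
  suffices H : (memLp_schrodingerSymbol_mul t (𝓕 ((memLp_complexGaussian d hz).toLp _))).toLp _ =
      𝓕 (c • (memLp_complexGaussian d hz').toLp _) by
    rw [H, FourierTransform.fourierInv_fourier_eq]
  rw [FourierTransform.fourier_smul, fourier_toLp_complexGaussian d hz', smul_smul, hc]
  apply Lp.ext
  rw [fourier_toLp_complexGaussian d hz]
  filter_upwards [MemLp.coeFn_toLp (memLp_schrodingerSymbol_mul t
      ((1 / z) ^ ((d : ℂ) / 2) • (memLp_complexGaussian d (re_one_div_pos hz)).toLp _)),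
    Lp.coeFn_smul ((1 / z) ^ ((d : ℂ) / 2)) ((memLp_complexGaussian d (re_one_div_pos hz)).toLp _),
    Lp.coeFn_smul ((1 / z) ^ ((d : ℂ) / 2)) ((memLp_complexGaussian d (re_one_div_pos hz')).toLp _),
    (memLp_complexGaussian d (re_one_div_pos hz)).coeFn_toLp,
    (memLp_complexGaussian d (re_one_div_pos hz')).coeFn_toLp] with ξ h1 h2 h3 h4 h5
  rw [h1, h2, h3]
  simp only [Pi.smul_apply, smul_eq_mul]
  rw [h4, h5, mul_left_comm]
  congr 1
  rw [complexGaussian, complexGaussian, schrodingerSymbol, ← Complex.exp_add, h]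
  congr 1
  push_cast; ring

/-! ### Laplace transform and moments of the Laguerre measure -/

theorem laguerreMeasure_eq_map {d : ℕ} (hd : 1 ≤ d) :
    laguerreMeasure ((d : ℝ) / 2 - 1) =
      ((volume : Measure (EuclideanSpace ℝ (Fin d))).withDensity
        (fun x => ENNReal.ofReal (Real.exp (-(Real.pi * ‖x‖ ^ 2))))).map
        (fun x => Real.pi * ‖x‖ ^ 2) := by
  rw [map_gaussian_eq_laguerreMeasure hd Real.pi_pos, div_self Real.pi_ne_zero, Real.one_rpow,
    ENNReal.ofReal_one, one_smul]

theorem integrable_cexp_laguerreMeasure {d : ℕ} (hd : 1 ≤ d) {σ : ℂ} (hσ : 0 < (1 + σ).re) :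
    Integrable (fun x : ℝ => Complex.exp (-(σ * x))) (laguerreMeasure ((d : ℝ) / 2 - 1)) := by
  rw [laguerreMeasure_eq_map hd, integrable_map_measure (by fun_prop) (by fun_prop),
    integrable_withDensity_iff_integrable_smul' (by fun_prop) (by simp)]
  refine (integrable_complexGaussian d hσ).congr (Eventually.of_forall fun x => ?_)
  simp only [complexGaussian, Function.comp_apply, Real.exp_nonneg, ENNReal.toReal_ofReal,
    Complex.real_smul]
  rw [Complex.ofReal_exp, ← Complex.exp_add]
  congr 1; push_cast; ring

theorem integral_cexp_laguerreMeasure {d : ℕ} (hd : 1 ≤ d) {σ : ℂ} (hσ : 0 < (1 + σ).re) :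
    ∫ x : ℝ, Complex.exp (-(σ * x)) ∂(laguerreMeasure ((d : ℝ) / 2 - 1)) =
      (1 / (1 + σ)) ^ ((d : ℂ) / 2) := by
  rw [laguerreMeasure_eq_map hd, integral_map (by fun_prop) (by fun_prop),
    integral_withDensity_eq_integral_toReal_smul (by fun_prop) (by simp)]
  have h := GaussianFourier.integral_cexp_neg_mul_sq_norm_add (V := EuclideanSpace ℝ (Fin d))
    (b := Real.pi * (1 + σ)) (by rw [Complex.re_ofReal_mul]; positivity) 0 0
  have hz0 : 1 + σ ≠ 0 := by intro h; simp [h] at hσ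
  have hpi : (Real.pi : ℂ) ≠ 0 := by exact_mod_cast Real.pi_ne_zero
  have e1 : (Real.pi : ℂ) / (Real.pi * (1 + σ)) = 1 / (1 + σ) := by field_simp
  rw [e1, finrank_euclideanSpace, Fintype.card_fin] at h
  simp only [inner_zero_left, Complex.ofReal_zero, mul_zero, add_zero, norm_zero, ne_eq,
    OfNat.ofNat_ne_zero, not_false_eq_true, zero_pow, zero_div, Complex.exp_zero, mul_one] at h
  rw [← h]
  refine integral_congr_ae (Eventually.of_forall fun x => ?_)
  simp only [Real.exp_nonneg, ENNReal.toReal_ofReal, Complex.real_smul]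
  rw [Complex.ofReal_exp, ← Complex.exp_add]
  congr 1; push_cast; ring

theorem isProbabilityMeasure_laguerreMeasure {d : ℕ} (hd : 1 ≤ d) :
    IsProbabilityMeasure (laguerreMeasure ((d : ℝ) / 2 - 1)) := by
  have h := integral_cexp_laguerreMeasure hd (σ := 0) (by simp)
  refine ⟨?_⟩
  simpa [Measure.real, ENNReal.toReal_eq_one_iff] using h

theorem prod_Ioc_add_natCast_pos {ν : ℝ} (hν : 0 < ν + 1) (k n : ℕ) :
    0 < ∏ j ∈ Finset.Ioc k n, (ν + (j : ℝ)) := by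
  refine Finset.prod_pos fun j hj => ?_
  have : (1 : ℝ) ≤ j := by exact_mod_cast (by have := (Finset.mem_Ioc.1 hj).1; omega)
  linarith

theorem Gamma_add_natCast_add_one {ν : ℝ} (hν : 0 < ν + 1) (k : ℕ) :
    Real.Gamma (ν + k + 1) =
      (∏ j ∈ Finset.Ioc 0 k, (ν + (j : ℝ))) * Real.Gamma (ν + 1) := by
  induction k with
  | zero => simp
  | succ k ih =>
    have : ν + (k + 1 : ℕ) + 1 = (ν + k + 1) + 1 := by push_cast; ring
    have hk : (0 : ℝ) ≤ k := k.cast_nonneg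
    rw [this, Real.Gamma_add_one (by linarith), ih, Finset.prod_Ioc_succ_top (by omega)]
    push_cast; ring

theorem integral_laguerreMeasure {ν : ℝ} (hν : 0 < ν + 1) (f : ℝ → ℂ) :
    ∫ x, f x ∂(laguerreMeasure ν) =
      ∫ x in Set.Ioi 0, (Real.exp (-x) * x ^ ν / Real.Gamma (ν + 1)) • f x := by
  rw [laguerreMeasure, integral_withDensity_eq_integral_toReal_smul (by fun_prop) (by simp)]
  refine setIntegral_congr_fun measurableSet_Ioi fun x hx => ?_
  have hx : 0 < x := hx
  have := Real.Gamma_pos_of_pos hν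
  rw [ENNReal.toReal_ofReal (by positivity)]

theorem integrable_laguerreMeasure_iff {ν : ℝ} (hν : 0 < ν + 1) (f : ℝ → ℂ) :
    Integrable f (laguerreMeasure ν) ↔
      IntegrableOn (fun x => (Real.exp (-x) * x ^ ν / Real.Gamma (ν + 1)) • f x)
        (Set.Ioi 0) := by
  rw [laguerreMeasure, integrable_withDensity_iff_integrable_smul' (by fun_prop) (by simp)]
  refine integrableOn_congr_fun (fun x hx => ?_) measurableSet_Ioi
  have hx : 0 < x := hx
  have := Real.Gamma_pos_of_pos hν
  rw [ENNReal.toReal_ofReal (by positivity)]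

theorem laguerreDensity_smul_pow_mul {ν : ℝ} (hν : 0 < ν + 1) (k : ℕ) (f : ℝ → ℂ) {x : ℝ}
    (hx : 0 < x) :
    (Real.exp (-x) * x ^ ν / Real.Gamma (ν + 1)) • ((x : ℂ) ^ k * f x) =
      ((∏ j ∈ Finset.Ioc 0 k, (ν + (j : ℝ)) : ℝ) : ℂ) *
      (Real.exp (-x) * x ^ (ν + k) / Real.Gamma (ν + k + 1)) • f x := by
  have hP := prod_Ioc_add_natCast_pos hν 0 k
  have hG := Real.Gamma_pos_of_pos hν
  rw [Gamma_add_natCast_add_one hν, Real.rpow_add hx, Real.rpow_natCast, Complex.real_smul,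
    Complex.real_smul, ← mul_assoc, ← mul_assoc]
  congr 1
  rw [← Complex.ofReal_pow, ← Complex.ofReal_mul, ← Complex.ofReal_mul]
  congr 1
  field_simp

/-- The factor `x^k` turns the density of index `ν` into a multiple of that of index `ν + k`, which
amounts to replacing the dimension `d` by `d + 2k`. Moments thus follow from Gaussian integrals. -/
theorem integral_pow_mul_laguerreMeasure {ν : ℝ} (hν : 0 < ν + 1) (k : ℕ) (f : ℝ → ℂ) :
    ∫ x : ℝ, (x : ℂ) ^ k * f x ∂(laguerreMeasure ν) =
      ((∏ j ∈ Finset.Ioc 0 k, (ν + (j : ℝ)) : ℝ) : ℂ) * ∫ x, f x ∂(laguerreMeasure (ν + k)) := by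
  have hk : (0 : ℝ) ≤ k := k.cast_nonneg
  rw [integral_laguerreMeasure hν, integral_laguerreMeasure (by linarith),
    ← integral_const_mul]
  exact setIntegral_congr_fun measurableSet_Ioi fun x hx => laguerreDensity_smul_pow_mul hν k f hx

theorem integrable_pow_mul_laguerreMeasure {ν : ℝ} (hν : 0 < ν + 1) (k : ℕ) {f : ℝ → ℂ}
    (hf : Integrable f (laguerreMeasure (ν + k))) :
    Integrable (fun x : ℝ => (x : ℂ) ^ k * f x) (laguerreMeasure ν) := by
  have hk : (0 : ℝ) ≤ k := k.cast_nonneg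
  rw [integrable_laguerreMeasure_iff (by linarith)] at hf
  rw [integrable_laguerreMeasure_iff hν]
  exact IntegrableOn.congr_fun (hf.const_mul _)
    (fun x hx => (laguerreDensity_smul_pow_mul hν k f hx).symm) measurableSet_Ioi

theorem integrable_pow_mul_cexp_laguerreMeasure {d : ℕ} (hd : 1 ≤ d) {σ : ℂ}
    (hσ : 0 < (1 + σ).re) (k : ℕ) :
    Integrable (fun x : ℝ => (x : ℂ) ^ k * Complex.exp (-(σ * x)))
      (laguerreMeasure ((d : ℝ) / 2 - 1)) := by
  have hd' : (0 : ℝ) < d := by exact_mod_cast hd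
  apply integrable_pow_mul_laguerreMeasure (by simpa)
  have h := integrable_cexp_laguerreMeasure (d := d + 2 * k) (by omega) hσ
  convert h using 2
  push_cast; ring

theorem integral_pow_mul_cexp_laguerreMeasure {d : ℕ} (hd : 1 ≤ d) {σ : ℂ}
    (hσ : 0 < (1 + σ).re) (k : ℕ) :
    ∫ x : ℝ, (x : ℂ) ^ k * Complex.exp (-(σ * x)) ∂(laguerreMeasure ((d : ℝ) / 2 - 1)) =
      ((∏ j ∈ Finset.Ioc 0 k, ((d : ℝ) / 2 - 1 + (j : ℝ)) : ℝ) : ℂ) *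
        ((1 / (1 + σ)) ^ ((d : ℂ) / 2) * (1 / (1 + σ)) ^ k) := by
  have hd' : (0 : ℝ) < d := by exact_mod_cast hd
  have hz0 : 1 + σ ≠ 0 := by intro h; simp [h] at hσ
  rw [integral_pow_mul_laguerreMeasure (by simpa)]
  congr 1
  have h := integral_cexp_laguerreMeasure (d := d + 2 * k) (by omega) hσ
  have e1 : ((d + 2 * k : ℕ) : ℝ) / 2 - 1 = d / 2 - 1 + k := by push_cast; ring
  have e2 : ((d + 2 * k : ℕ) : ℂ) / 2 = d / 2 + k := by push_cast; ring
  rw [e1, e2, Complex.cpow_add _ _ (by simpa using hz0), Complex.cpow_natCast] at h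
  exact h

/-! ### Integrals of Laguerre polynomials and orthogonality -/

theorem laguerreL_eq_sum_choose {ν : ℝ} (hν : 0 < ν + 1) (n : ℕ) (x : ℝ) :
    (laguerreL ν n x : ℂ) = ((∏ j ∈ Finset.Ioc 0 n, (ν + (j : ℝ)) : ℝ) : ℂ) / (n.factorial : ℂ) *
      ∑ k ∈ Finset.range (n + 1), (-1) ^ k * (n.choose k : ℂ) *
        ((∏ j ∈ Finset.Ioc 0 k, (ν + (j : ℝ)) : ℝ) : ℂ)⁻¹ * (x : ℂ) ^ k := by
  rw [laguerreL, Finset.mul_sum, Complex.ofReal_sum]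
  refine Finset.sum_congr rfl fun k hk => ?_
  have hk : k ≤ n := by simpa [Nat.lt_succ_iff] using hk
  have hsplit : (∏ j ∈ Finset.Ioc 0 n, (ν + (j : ℝ))) =
      (∏ j ∈ Finset.Ioc 0 k, (ν + (j : ℝ))) * ∏ j ∈ Finset.Ioc k n, (ν + (j : ℝ)) := by
    rw [← Finset.prod_union (Finset.disjoint_left.2 fun j hj hj' => by
      simp only [Finset.mem_Ioc] at hj hj'; omega), Finset.Ioc_union_Ioc_eq_Ioc (by omega) hk]
  have hP := (prod_Ioc_add_natCast_pos hν 0 k).ne'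
  rw [hsplit, Nat.cast_choose ℂ hk]
  have h1 : ((∏ j ∈ Finset.Ioc 0 k, (ν + (j : ℝ)) : ℝ) : ℂ) ≠ 0 := by exact_mod_cast hP
  have h2 : (n.factorial : ℂ) ≠ 0 := by exact_mod_cast n.factorial_ne_zero
  have h3 : (k.factorial : ℂ) ≠ 0 := by exact_mod_cast k.factorial_ne_zero
  have h4 : ((n - k).factorial : ℂ) ≠ 0 := by exact_mod_cast (n - k).factorial_ne_zero
  rw [Complex.ofReal_mul, Complex.ofReal_mul, Complex.ofReal_mul]
  push_cast at h1 ⊢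
  field_simp

/-- The moments cancel the products in the denominators, and the binomial theorem sums what is left
to `(1 - 1/(1+σ))^n`. -/
theorem integral_laguerreL_mul_cexp {d : ℕ} (hd : 1 ≤ d) {σ : ℂ} (hσ : 0 < (1 + σ).re) (n : ℕ) :
    ∫ x : ℝ, (laguerreL ((d : ℝ) / 2 - 1) n x : ℂ) * Complex.exp (-(σ * x))
      ∂(laguerreMeasure ((d : ℝ) / 2 - 1)) =
      ((∏ j ∈ Finset.Ioc 0 n, ((d : ℝ) / 2 - 1 + (j : ℝ)) : ℝ) : ℂ) / (n.factorial : ℂ) *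
        ((1 / (1 + σ)) ^ ((d : ℂ) / 2) * (σ / (1 + σ)) ^ n) := by
  have hd' : (0 : ℝ) < d := by exact_mod_cast hd
  have hν : 0 < (d : ℝ) / 2 - 1 + 1 := by simpa
  have hz0 : 1 + σ ≠ 0 := by intro h; simp [h] at hσ
  simp only [laguerreL_eq_sum_choose hν, mul_assoc, Finset.sum_mul, integral_const_mul]
  rw [integral_finsetSum _ (fun k _ => by
    iterate 3 apply Integrable.const_mul
    exact integrable_pow_mul_cexp_laguerreMeasure hd hσ k)]
  congr 1
  have e : σ / (1 + σ) = -(1 / (1 + σ)) + 1 := by field_simp; ring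
  rw [e, add_pow, Finset.mul_sum]
  refine Finset.sum_congr rfl fun k _ => ?_
  have h1 : ((∏ j ∈ Finset.Ioc 0 k, ((d : ℝ) / 2 - 1 + (j : ℝ)) : ℝ) : ℂ) ≠ 0 := by
    exact_mod_cast (prod_Ioc_add_natCast_pos hν 0 k).ne'
  rw [integral_const_mul, integral_const_mul, integral_const_mul,
    integral_pow_mul_cexp_laguerreMeasure hd hσ, neg_pow, inv_mul_cancel_left₀ h1, one_pow]
  ring

/-- The quotient of the moments of orders `k + j` and `k` is a polynomial in `k` of degree `j`. The
alternating binomial sum is its `n`-th finite difference, which vanishes for `j < n`. -/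
theorem integral_laguerreL_mul_pow_eq_zero {d : ℕ} (hd : 1 ≤ d) {j n : ℕ} (hj : j < n) :
    ∫ x : ℝ, (laguerreL ((d : ℝ) / 2 - 1) n x : ℂ) * (x : ℂ) ^ j
      ∂(laguerreMeasure ((d : ℝ) / 2 - 1)) = 0 := by
  have hd' : (0 : ℝ) < d := by exact_mod_cast hd
  set ν := (d : ℝ) / 2 - 1 with hνd
  have hν : 0 < ν + 1 := by simpa [hνd]
  have hint (k : ℕ) : Integrable (fun x : ℝ => (x : ℂ) ^ k) (laguerreMeasure ν) := by
    simpa using integrable_pow_mul_cexp_laguerreMeasure hd (σ := 0) (by simp) k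
  have hval (k : ℕ) : ∫ x : ℝ, (x : ℂ) ^ k ∂(laguerreMeasure ν) =
      ((∏ j ∈ Finset.Ioc 0 k, (ν + (j : ℝ)) : ℝ) : ℂ) := by
    rw [hνd]
    simpa using integral_pow_mul_cexp_laguerreMeasure hd (σ := 0) (by simp) k
  simp only [laguerreL_eq_sum_choose hν, mul_assoc, Finset.sum_mul, integral_const_mul, ← pow_add]
  rw [integral_finsetSum _ (fun k _ => by
    iterate 3 apply Integrable.const_mul
    exact hint _)]
  simp only [integral_const_mul, hval]
  let Q : Polynomial ℂ := ∏ i ∈ Finset.range j, (Polynomial.X + Polynomial.C ((ν + 1 + i : ℝ) : ℂ))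
  have hQdeg : Q.natDegree < n := by
    rw [Polynomial.natDegree_prod_of_monic _ _ fun i _ => Polynomial.monic_X_add_C _]
    simpa only [Polynomial.natDegree_X_add_C, Finset.sum_const, Finset.card_range, smul_eq_mul,
      mul_one] using hj
  have hQ (k : ℕ) : ((∏ i ∈ Finset.Ioc 0 k, (ν + (i : ℝ)) : ℝ) : ℂ)⁻¹ *
      ((∏ i ∈ Finset.Ioc 0 (k + j), (ν + (i : ℝ)) : ℝ) : ℂ) = Q.eval (k : ℂ) := by
    have h1 : ((∏ j ∈ Finset.Ioc 0 k, (ν + (j : ℝ)) : ℝ) : ℂ) ≠ 0 := by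
      exact_mod_cast (prod_Ioc_add_natCast_pos hν 0 k).ne'
    rw [inv_mul_eq_iff_eq_mul₀ h1, Polynomial.eval_prod]
    clear hQdeg hj Q
    induction j with
    | zero => simp
    | succ j ih =>
      rw [← add_assoc, Finset.prod_Ioc_succ_top (by omega), Finset.prod_range_succ,
        Complex.ofReal_mul, ih]
      simp only [Polynomial.eval_add, Polynomial.eval_X, Polynomial.eval_C]
      push_cast
      ring
  simp only [hQ]
  have h := congrFun (Polynomial.fwdDiff_iter_eq_zero_of_degree_lt hQdeg) 0
  rw [fwdDiff_iter_eq_sum_shift] at h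
  have h' : ∑ k ∈ Finset.range (n + 1), (-1 : ℂ) ^ k * ((n.choose k : ℂ) * Q.eval (k : ℂ)) =
      (-1) ^ n * ∑ k ∈ Finset.range (n + 1),
        ((-1 : ℤ) ^ (n - k) * n.choose k) • Q.eval (0 + k • (1 : ℂ)) := by
    rw [Finset.mul_sum]
    refine Finset.sum_congr rfl fun k hk => ?_
    have hk : k ≤ n := by simpa [Nat.lt_succ_iff] using hk
    have e : (-1 : ℂ) ^ n * (-1) ^ (n - k) = (-1) ^ k := by
      rw [← pow_add, show n + (n - k) = 2 * (n - k) + k by omega, pow_add, pow_mul]; simp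
    rw [← e]
    simp
    ring
  rw [h', h]; simp

theorem integrable_laguerreL_mul_pow {d : ℕ} (hd : 1 ≤ d) (n j : ℕ) :
    Integrable (fun x : ℝ => (laguerreL ((d : ℝ) / 2 - 1) n x : ℂ) * (x : ℂ) ^ j)
      (laguerreMeasure ((d : ℝ) / 2 - 1)) := by
  have hd' : (0 : ℝ) < d := by exact_mod_cast hd
  have hint (k : ℕ) : Integrable (fun x : ℝ => (x : ℂ) ^ k)
      (laguerreMeasure ((d : ℝ) / 2 - 1)) := by
    simpa using integrable_pow_mul_cexp_laguerreMeasure hd (σ := 0) (by simp) k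
  simp only [laguerreL_eq_sum_choose (show 0 < (d : ℝ) / 2 - 1 + 1 by simpa), mul_assoc,
    Finset.sum_mul, ← pow_add]
  apply Integrable.const_mul
  refine integrable_finsetSum _ fun k _ => ?_
  iterate 3 apply Integrable.const_mul
  exact hint _

theorem integral_laguerreL_mul_laguerreL_eq_zero {d : ℕ} (hd : 1 ≤ d) {m n : ℕ} (hmn : m ≠ n) :
    ∫ x : ℝ, (laguerreL ((d : ℝ) / 2 - 1) m x : ℂ) * (laguerreL ((d : ℝ) / 2 - 1) n x : ℂ)
      ∂(laguerreMeasure ((d : ℝ) / 2 - 1)) = 0 := by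
  have hd' : (0 : ℝ) < d := by exact_mod_cast hd
  wlog h : n < m generalizing m n
  · rw [← this hmn.symm (by omega)]
    simp only [mul_comm]
  have hν : 0 < (d : ℝ) / 2 - 1 + 1 := by simpa
  simp only [laguerreL_eq_sum_choose hν n, mul_left_comm _ (_ / _), Finset.mul_sum]
  simp only [← Finset.mul_sum, integral_const_mul, mul_left_comm (laguerreL _ _ _ : ℂ)]
  rw [integral_finsetSum _ (fun k _ => by
    apply Integrable.const_mul
    exact integrable_laguerreL_mul_pow hd m k)]
  refine mul_eq_zero_of_right _ (Finset.sum_eq_zero fun k hk => ?_)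
  have hk : k ≤ n := by simpa [Nat.lt_succ_iff] using hk
  rw [integral_const_mul, integral_laguerreL_mul_pow_eq_zero hd (by omega), mul_zero]

/-! ### Functions representing elements of a subspace of `L²` -/

section AEMem
variable {X : Type*} [MeasurableSpace X] {μ : Measure X}

/-- The function `f` represents an element of the subspace `V` of `L²(μ)`. -/
def AEMem (V : Submodule ℂ (Lp ℂ 2 μ)) (f : X → ℂ) : Prop := ∃ u ∈ V, ⇑u =ᵐ[μ] f

variable {V : Submodule ℂ (Lp ℂ 2 μ)} {f g : X → ℂ}

theorem AEMem.memLp (hf : AEMem V f) : MemLp f 2 μ := by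
  obtain ⟨u, _, hu⟩ := hf
  exact (memLp_congr_ae hu).1 (Lp.memLp u)

theorem AEMem.congr (hf : AEMem V f) (h : f =ᵐ[μ] g) : AEMem V g := by
  obtain ⟨u, hV, hu⟩ := hf
  exact ⟨u, hV, hu.trans h⟩

theorem AEMem.add (hf : AEMem V f) (hg : AEMem V g) : AEMem V (fun x => f x + g x) := by
  obtain ⟨u, hV, hu⟩ := hf
  obtain ⟨v, hV', hv⟩ := hg
  exact ⟨u + v, V.add_mem hV hV', (Lp.coeFn_add u v).trans (hu.add hv)⟩

theorem AEMem.const_mul (hf : AEMem V f) (c : ℂ) : AEMem V (fun x => c * f x) := by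
  obtain ⟨u, hV, hu⟩ := hf
  refine ⟨c • u, V.smul_mem c hV, (Lp.coeFn_smul c u).trans ?_⟩
  filter_upwards [hu] with x hx
  simp [hx]

theorem AEMem.sum {ι : Type*} {s : Finset ι} {f : ι → X → ℂ} (hf : ∀ i ∈ s, AEMem V (f i)) :
    AEMem V (fun x => ∑ i ∈ s, f i x) := by
  classical
  induction s using Finset.induction_on with
  | empty => exact ⟨0, V.zero_mem, by simpa using! Lp.coeFn_zero ℂ 2 μ⟩
  | insert i s hi ih =>
    simp only [Finset.sum_insert hi]
    exact (hf i (by simp)).add (ih fun j hj => hf j (by simp [hj]))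

/-- Dominated convergence turns pointwise limits into `L²` limits, so a closed subspace keeps them.
-/
theorem AEMem.of_dominated (hV : IsClosed (V : Set (Lp ℂ 2 μ))) {F : ℕ → X → ℂ} {b : X → ℝ}
    (hF : ∀ n, AEMem V (F n)) (hb : MemLp b 2 μ) (hFb : ∀ n, ∀ᵐ x ∂μ, ‖F n x‖ ≤ b x)
    (hlim : ∀ᵐ x ∂μ, Tendsto (fun n => F n x) atTop (𝓝 (f x))) : AEMem V f := by
  have hfm : AEStronglyMeasurable f μ :=
    aestronglyMeasurable_of_tendsto_ae atTop (fun n => (hF n).memLp.1) hlim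
  have hfb : ∀ᵐ x ∂μ, ‖f x‖ ≤ b x := by
    filter_upwards [hlim, ae_all_iff.2 hFb] with x hx hx'
    exact le_of_tendsto hx.norm (Eventually.of_forall hx')
  have hf : MemLp f 2 μ := hb.of_le hfm (hfb.mono fun x hx => hx.trans (le_abs_self _))
  refine ⟨hf.toLp f, ?_, hf.coeFn_toLp⟩
  choose u huV hu using hF
  refine hV.mem_of_tendsto (f := u) (b := atTop) ?_ (Eventually.of_forall huV)
  rw [Lp.tendsto_Lp_iff_tendsto_eLpNorm']
  have h2 : ∀ n, eLpNorm (⇑(u n) - ⇑(hf.toLp f)) 2 μ =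
      (∫⁻ x, ‖u n x - f x‖ₑ ^ (2 : ℝ) ∂μ) ^ (1 / 2 : ℝ) := fun n => by
    rw [eLpNorm_eq_lintegral_rpow_enorm_toReal (by simp) (by simp)]
    simp only [ENNReal.toReal_ofNat]
    congr 1
    refine lintegral_congr_ae ?_
    filter_upwards [hf.coeFn_toLp] with x hx
    simp [hx]
  simp only [h2]
  have h0 : Tendsto (fun n => ∫⁻ x, ‖u n x - f x‖ₑ ^ (2 : ℝ) ∂μ) atTop
      (𝓝 (∫⁻ _, 0 ∂μ)) := by
    refine tendsto_lintegral_of_dominated_convergence' (fun x => ‖2 * b x‖ₑ ^ (2 : ℝ))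
      (fun n => (((Lp.aestronglyMeasurable (u n)).sub hfm).enorm.pow_const _)) ?_ ?_ ?_
    · intro n
      filter_upwards [hu n, hFb n, hfb] with x h1 h2 h3
      gcongr
      rw [h1, enorm_le_iff_norm_le]
      calc ‖F n x - f x‖ ≤ ‖F n x‖ + ‖f x‖ := norm_sub_le _ _
        _ ≤ 2 * b x := by linarith
        _ ≤ ‖2 * b x‖ := le_abs_self _
    · have := (hb.const_mul 2)
      have h := lintegral_rpow_enorm_lt_top_of_eLpNorm_lt_top (p := 2) (by simp) (by simp) this.2
      simpa using h.ne
    · filter_upwards [hlim, ae_all_iff.2 hu] with x h1 h2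
      simp only [h2]
      have h3 : Tendsto (fun n => ‖F n x - f x‖ₑ) atTop (𝓝 0) := by
        have := (tendsto_sub_nhds_zero_iff.2 h1).enorm
        simpa using this
      have := h3.ennrpow_const 2
      simpa using this
  have := h0.ennrpow_const (1 / 2)
  simpa using this

end AEMem

/-! ### Totality of the Laguerre polynomials and of the exponentials -/

theorem ae_pos_laguerreMeasure (ν : ℝ) : ∀ᵐ x ∂(laguerreMeasure ν), 0 < x :=
  (withDensity_absolutelyContinuous _ _).ae_le (ae_restrict_mem measurableSet_Ioi)

theorem memLp_pow_mul_cexp {d : ℕ} (hd : 1 ≤ d) {σ : ℂ} (hσ : 0 < 1 + 2 * σ.re) (m : ℕ) :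
    MemLp (fun x : ℝ => (x : ℂ) ^ m * Complex.exp (-(σ * x))) 2
      (laguerreMeasure ((d : ℝ) / 2 - 1)) := by
  rw [memLp_two_iff_integrable_sq_norm (by fun_prop)]
  refine (integrable_pow_mul_cexp_laguerreMeasure hd (σ := 2 * σ) (by simpa using hσ)
    (2 * m)).norm.congr (Eventually.of_forall fun x => ?_)
  simp only
  rw [← norm_pow, mul_pow, ← Complex.exp_nat_mul, ← pow_mul, mul_comm 2 m]
  congr 3; push_cast; ring

theorem memLp_laguerreL {d : ℕ} (hd : 1 ≤ d) (n : ℕ) :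
    MemLp (fun x : ℝ => (laguerreL ((d : ℝ) / 2 - 1) n x : ℂ)) 2
      (laguerreMeasure ((d : ℝ) / 2 - 1)) := by
  have hd' : (0 : ℝ) < d := by exact_mod_cast hd
  simp only [laguerreL_eq_sum_choose (show 0 < (d : ℝ) / 2 - 1 + 1 by simpa)]
  apply MemLp.const_mul
  refine memLp_finsetSum _ fun k _ => ?_
  apply MemLp.const_mul
  simpa using memLp_pow_mul_cexp hd (σ := 0) (by simp) k

section Density
variable {d : ℕ} {V : Submodule ℂ (LaguerreL2 ((d : ℝ) / 2 - 1))}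

theorem AEMem.pow_of_laguerreL (hd : 1 ≤ d)
    (hL : ∀ n, AEMem V (fun x => (laguerreL ((d : ℝ) / 2 - 1) n x : ℂ))) (n : ℕ) :
    AEMem V (fun x : ℝ => (x : ℂ) ^ n) := by
  have hd' : (0 : ℝ) < d := by exact_mod_cast hd
  have hν : 0 < (d : ℝ) / 2 - 1 + 1 := by simpa
  induction n using Nat.strong_induction_on with
  | _ n ih =>
    have hP (k : ℕ) : ((∏ j ∈ Finset.Ioc 0 k, ((d : ℝ) / 2 - 1 + (j : ℝ)) : ℝ) : ℂ) ≠ 0 := by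
      exact_mod_cast (prod_Ioc_add_natCast_pos hν 0 k).ne'
    set P : ℕ → ℂ := fun k => ((∏ j ∈ Finset.Ioc 0 k, ((d : ℝ) / 2 - 1 + (j : ℝ)) : ℝ) : ℂ)
      with hPd
    have h2 : (n.factorial : ℂ) ≠ 0 := by exact_mod_cast n.factorial_ne_zero
    have hsum : AEMem V (fun x : ℝ => ∑ k ∈ Finset.range n, (-1) ^ k * (n.choose k : ℂ) *
        (P k)⁻¹ * (x : ℂ) ^ k) :=
      AEMem.sum fun k hk => (ih k (Finset.mem_range.1 hk)).const_mul _
    have h := (((hL n).const_mul (n.factorial / P n)).add (hsum.const_mul (-1))).const_mul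
      ((-1) ^ n * P n)
    refine h.congr (Eventually.of_forall fun x => ?_)
    simp only [laguerreL_eq_sum_choose hν, Finset.sum_range_succ _ n]
    have h1 := hP n
    change P n ≠ 0 at h1
    have e : ((-1 : ℂ) ^ n) * (-1) ^ n = 1 := by rw [← mul_pow]; simp
    set S : ℂ := ∑ k ∈ Finset.range n, (-1) ^ k * (n.choose k : ℂ) * (P k)⁻¹ * (x : ℂ) ^ k
    change (-1) ^ n * P n * (n.factorial / P n * (P n / n.factorial * (S + (-1) ^ n *
      (n.choose n : ℂ) * (P n)⁻¹ * (x : ℂ) ^ n)) + -1 * S) = _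
    rw [Nat.choose_self]
    field_simp
    linear_combination (x : ℂ) ^ n * e

/-- The Taylor sums of `e^{-cx}` are dominated by `e^{cx}`, which lies in `L²(μ_ν)` only for `c <
1/2`. Larger decay rates are therefore reached in steps of `1/4`, with all powers of `x` carried
through the induction. -/
theorem AEMem.pow_mul_exp (hd : 1 ≤ d) (hV : IsClosed (V : Set (LaguerreL2 ((d : ℝ) / 2 - 1))))
    (hp : ∀ n, AEMem V (fun x : ℝ => (x : ℂ) ^ n)) (k : ℕ) :
    ∀ m : ℕ, AEMem V (fun x : ℝ => (x : ℂ) ^ m * Complex.exp (-((k / 4 : ℝ) * x))) := by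
  induction k with
  | zero => simpa using hp
  | succ k ih =>
    intro m
    have hb := (memLp_pow_mul_cexp hd (σ := ((-(1 / 4) : ℝ) : ℂ))
      (by rw [Complex.ofReal_re]; norm_num) m).norm
    refine AEMem.of_dominated hV (F := fun N x => ∑ i ∈ Finset.range N,
      ((-(1 / 4)) ^ i / (i.factorial : ℂ)) * ((x : ℂ) ^ (m + i) *
        Complex.exp (-((k / 4 : ℝ) * x)))) (fun N => AEMem.sum fun i _ => (ih _).const_mul _)
      hb (fun N => ?_) (Eventually.of_forall fun x => ?_)
    · filter_upwards [ae_pos_laguerreMeasure _] with x hx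
      have e : ∑ i ∈ Finset.range N, ((-(1 / 4)) ^ i / (i.factorial : ℂ)) * ((x : ℂ) ^ (m + i) *
          Complex.exp (-((k / 4 : ℝ) * x))) = (x : ℂ) ^ m * ((∑ i ∈ Finset.range N,
          (-(x / 4) : ℂ) ^ i / (i.factorial : ℂ)) * Complex.exp (-((k / 4 : ℝ) * x))) := by
        rw [Finset.sum_mul, Finset.mul_sum]
        refine Finset.sum_congr rfl fun i _ => ?_
        rw [show (-(x / 4) : ℂ) = -(1 / 4) * x by ring, mul_pow, pow_add]; ring
      rw [e, norm_mul, norm_mul, norm_mul]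
      gcongr
      have h1 : ‖Complex.exp (-((k / 4 : ℝ) * x))‖ ≤ 1 := by
        rw [← Complex.ofReal_mul, ← Complex.ofReal_neg, Complex.norm_exp_ofReal]
        exact Real.exp_le_one_iff.2 (neg_nonpos.2 (by positivity))
      have h2 : ‖∑ i ∈ Finset.range N, (-(x / 4) : ℂ) ^ i / (i.factorial : ℂ)‖ ≤
          Real.exp (x / 4) := by
        refine (norm_sum_le _ _).trans (le_trans (le_of_eq (Finset.sum_congr rfl fun i _ => ?_))
          (Real.sum_le_exp_of_nonneg (x := x / 4) (by positivity) N))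
        simp [abs_of_pos hx]
      have h3 : ‖Complex.exp (-(((-(1 / 4) : ℝ) : ℂ) * x))‖ = Real.exp (x / 4) := by
        rw [← Complex.ofReal_mul, ← Complex.ofReal_neg, Complex.norm_exp_ofReal]
        congr 1; ring
      rw [h3]
      exact (mul_le_mul h2 h1 (norm_nonneg _) (Real.exp_pos _).le).trans_eq (mul_one _)
    · have h := ((NormedSpace.expSeries_div_hasSum_exp (-(x / 4) : ℂ)).tendsto_sum_nat.const_mul
        ((x : ℂ) ^ m)).mul_const (Complex.exp (-((k / 4 : ℝ) * x)))
      rw [← Complex.exp_eq_exp_ℂ, mul_assoc, ← Complex.exp_add] at h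
      convert h using 2 with N
      · rw [Finset.mul_sum, Finset.sum_mul]
        refine Finset.sum_congr rfl fun i _ => ?_
        rw [show (-(x / 4) : ℂ) = -(1 / 4) * x by ring, mul_pow, pow_add]; ring
      · congr 2; push_cast; ring

theorem AEMem.polynomial_exp
    (hE : ∀ k : ℕ, AEMem V (fun x : ℝ => Complex.exp (-((k / 4 : ℝ) * x)))) (p : Polynomial ℂ) :
    AEMem V (fun x : ℝ => p.eval (Complex.exp (-(x / 4)))) := by
  simp only [Polynomial.eval_eq_sum_range]
  refine AEMem.sum fun k _ => ((hE k).const_mul (p.coeff k)).congr (Eventually.of_forall fun x => ?_)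
  simp only
  rw [← Complex.exp_nat_mul]
  congr 2; push_cast; ring

theorem AEMem.continuousMap_exp [IsFiniteMeasure (laguerreMeasure ((d : ℝ) / 2 - 1))]
    (hV : IsClosed (V : Set (LaguerreL2 ((d : ℝ) / 2 - 1))))
    (hE : ∀ k : ℕ, AEMem V (fun x : ℝ => Complex.exp (-((k / 4 : ℝ) * x))))
    (ψ : C(unitInterval, ℂ)) :
    AEMem V (fun x : ℝ => ψ (Set.projIcc 0 1 zero_le_one (Real.exp (-(x / 4))))) := by
  have hlim := bernsteinApproximation_uniform ψ
  obtain ⟨B, hB⟩ := (Metric.isBounded_range_of_tendsto _ hlim).exists_norm_le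
  refine AEMem.of_dominated hV (F := fun n x => bernsteinApproximation n ψ
    (Set.projIcc 0 1 zero_le_one (Real.exp (-(x / 4))))) (b := fun _ => B) (fun n => ?_)
    (memLp_const B) (fun n => Eventually.of_forall fun x => ?_)
    (Eventually.of_forall fun x => ?_)
  · let p : Polynomial ℂ := ∑ k : Fin (n + 1), Polynomial.C ((n.choose k : ℂ) *
      ψ (bernstein.z k)) * (Polynomial.X ^ (k : ℕ) * (1 - Polynomial.X) ^ (n - k))
    refine (AEMem.polynomial_exp hE p).congr ?_
    filter_upwards [ae_pos_laguerreMeasure _] with x hx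
    have hmem : Real.exp (-(x / 4)) ∈ Set.Icc (0 : ℝ) 1 :=
      ⟨(Real.exp_pos _).le, Real.exp_le_one_iff.2 (neg_nonpos.2 (by positivity))⟩
    rw [Set.projIcc_of_mem _ hmem, bernsteinApproximation.apply, Polynomial.eval_finsetSum]
    refine Finset.sum_congr rfl fun k _ => ?_
    rw [bernstein_apply]
    simp only [Polynomial.eval_mul, Polynomial.eval_C, Polynomial.eval_pow, Polynomial.eval_X,
      Polynomial.eval_sub, Polynomial.eval_one, Complex.real_smul]
    push_cast
    ring
  · exact (ContinuousMap.norm_coe_le_norm _ _).trans (hB _ ⟨n, rfl⟩)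
  · exact ((continuous_eval_const _).tendsto ψ).comp hlim

/-- The substitution `u = e^{-x/4}` maps the half-line into `(0, 1)`. Compact support makes `g(-4
log u)` vanish near `u = 0`, so it extends continuously to `[0, 1]` and Bernstein approximation
applies. -/
theorem AEMem.of_hasCompactSupport [IsFiniteMeasure (laguerreMeasure ((d : ℝ) / 2 - 1))]
    (hV : IsClosed (V : Set (LaguerreL2 ((d : ℝ) / 2 - 1))))
    (hE : ∀ k : ℕ, AEMem V (fun x : ℝ => Complex.exp (-((k / 4 : ℝ) * x))))
    {g : ℝ → ℂ} (hg : Continuous g) (hgc : HasCompactSupport g) : AEMem V g := by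
  let ψ₀ : ℝ → ℂ := fun u => if u ≤ 0 then 0 else g (-4 * Real.log u)
  have hψ : Continuous ψ₀ := by
    obtain ⟨R, hR⟩ := hgc.isCompact.isBounded.exists_norm_le
    have hzero : ∀ u < Real.exp (-(|R| + 1) / 4), ψ₀ u = 0 := fun u hu => by
      by_cases h0 : u ≤ 0
      · simp [ψ₀, h0]
      · simp only [ψ₀, h0, if_false]
        by_contra hne
        have h1 := hR _ (subset_tsupport g hne)
        have h2 : Real.log u < -(|R| + 1) / 4 := by
          rwa [Real.log_lt_iff_lt_exp (not_le.1 h0)]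
        rw [Real.norm_eq_abs] at h1
        have := le_abs_self (-4 * Real.log u)
        have := le_abs_self R
        linarith
    rw [continuous_iff_continuousAt]
    intro u
    rcases lt_or_ge 0 u with hu | hu
    · have : ContinuousAt (fun u => g (-4 * Real.log u)) u :=
        hg.continuousAt.comp ((Real.continuousAt_log hu.ne').const_mul (-4))
      refine this.congr ?_
      filter_upwards [lt_mem_nhds hu] with v hv
      simp [ψ₀, not_le.2 hv]
    · refine (continuousAt_const (y := (0 : ℂ))).congr ?_
      filter_upwards [gt_mem_nhds (lt_of_le_of_lt hu (Real.exp_pos (-(|R| + 1) / 4)))] with v hv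
      exact (hzero v hv).symm
  refine (AEMem.continuousMap_exp hV hE ⟨fun u => ψ₀ u, hψ.comp continuous_subtype_val⟩).congr ?_
  filter_upwards [ae_pos_laguerreMeasure _] with x hx
  have hmem : Real.exp (-(x / 4)) ∈ Set.Icc (0 : ℝ) 1 :=
    ⟨(Real.exp_pos _).le, Real.exp_le_one_iff.2 (neg_nonpos.2 (by positivity))⟩
  rw [Set.projIcc_of_mem _ hmem]
  simp only [ContinuousMap.coe_mk, ψ₀, not_le.2 (Real.exp_pos _), if_false, Real.log_exp]
  congr 1; ring

theorem eq_top_of_forall_aemem_exp (hd : 1 ≤ d)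
    (hV : IsClosed (V : Set (LaguerreL2 ((d : ℝ) / 2 - 1))))
    (hE : ∀ k : ℕ, AEMem V (fun x : ℝ => Complex.exp (-((k / 4 : ℝ) * x)))) : V = ⊤ := by
  have := isProbabilityMeasure_laguerreMeasure hd
  refine eq_top_iff.2 fun u _ => ?_
  rw [← SetLike.mem_coe, ← hV.closure_eq, EMetric.mem_closure_iff]
  intro ε hε
  obtain ⟨δ, hδ, hδε⟩ := exists_between hε
  obtain ⟨g, hgc, hgu, hg, -⟩ :=
    (Lp.memLp u).exists_hasCompactSupport_eLpNorm_sub_le (by simp) hδ.ne'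
  obtain ⟨v, hvV, hv⟩ := AEMem.of_hasCompactSupport hV hE hg hgc
  refine ⟨v, hvV, lt_of_le_of_lt ?_ hδε⟩
  rw [Lp.edist_def]
  refine le_trans (le_of_eq (eLpNorm_congr_ae ?_)) hgu
  exact (EventuallyEq.refl _ _).sub hv

theorem eq_top_of_forall_aemem_laguerreL (hd : 1 ≤ d)
    (hV : IsClosed (V : Set (LaguerreL2 ((d : ℝ) / 2 - 1))))
    (hL : ∀ n, AEMem V (fun x => (laguerreL ((d : ℝ) / 2 - 1) n x : ℂ))) : V = ⊤ :=
  eq_top_of_forall_aemem_exp hd hV fun k => by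
    simpa using AEMem.pow_mul_exp hd hV (AEMem.pow_of_laguerreL hd hL) k 0

end Density

/-! ### The Laguerre basis, phase operators and dilations -/

/-- Both arguments lie in `(-π/2, π/2)`, so their sum stays within the principal branch. -/
theorem cpow_mul_of_re_pos {x y : ℂ} (hx : 0 < x.re) (hy : 0 < y.re) (c : ℂ) :
    (x * y) ^ c = x ^ c * y ^ c := by
  have hx0 : x ≠ 0 := by rintro rfl; simp at hx
  have hy0 : y ≠ 0 := by rintro rfl; simp at hy
  have h1 := abs_lt.1 (Complex.abs_arg_lt_pi_div_two_iff.2 (Or.inl hx))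
  have h2 := abs_lt.1 (Complex.abs_arg_lt_pi_div_two_iff.2 (Or.inl hy))
  rw [Complex.cpow_def_of_ne_zero (mul_ne_zero hx0 hy0), Complex.cpow_def_of_ne_zero hx0,
    Complex.cpow_def_of_ne_zero hy0, ← Complex.exp_add, ← add_mul,
    Complex.log_mul hx0 hy0 ⟨by linarith, by linarith⟩]

/-- The Laguerre polynomial `L_n^{(d/2-1)}` as an element of `L²(ℝ₊, dμ_ν)`. -/
noncomputable def laguerreVec {d : ℕ} (hd : 1 ≤ d) (n : ℕ) : LaguerreL2 ((d : ℝ) / 2 - 1) :=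
  (memLp_laguerreL hd n).toLp _

theorem coeFn_laguerreVec {d : ℕ} (hd : 1 ≤ d) (n : ℕ) :
    laguerreVec hd n =ᵐ[laguerreMeasure ((d : ℝ) / 2 - 1)]
      fun x => (laguerreL ((d : ℝ) / 2 - 1) n x : ℂ) :=
  (memLp_laguerreL hd n).coeFn_toLp

theorem memLp_cexp {d : ℕ} (hd : 1 ≤ d) {σ : ℂ} (hσ : 0 < 1 + 2 * σ.re) :
    MemLp (fun x : ℝ => Complex.exp (-(σ * x))) 2 (laguerreMeasure ((d : ℝ) / 2 - 1)) := by
  simpa using memLp_pow_mul_cexp hd hσ 0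

/-- The exponential `e^{-σx}` as an element of `L²(ℝ₊, dμ_ν)`. -/
noncomputable def expVec {d : ℕ} (hd : 1 ≤ d) {σ : ℂ} (hσ : 0 < 1 + 2 * σ.re) :
    LaguerreL2 ((d : ℝ) / 2 - 1) :=
  (memLp_cexp hd hσ).toLp _

theorem inner_laguerreVec_toLp {d : ℕ} (hd : 1 ≤ d) (n : ℕ) {f : ℝ → ℂ}
    (hf : MemLp f 2 (laguerreMeasure ((d : ℝ) / 2 - 1))) :
    inner ℂ (laguerreVec hd n) (hf.toLp f) =
      ∫ x, (laguerreL ((d : ℝ) / 2 - 1) n x : ℂ) * f x ∂laguerreMeasure ((d : ℝ) / 2 - 1) := by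
  rw [L2.inner_def]
  refine integral_congr_ae ?_
  filter_upwards [coeFn_laguerreVec hd n, hf.coeFn_toLp] with x h1 h2
  rw [h1, h2]
  simp [mul_comm]

theorem inner_laguerreVec_laguerreVec {d : ℕ} (hd : 1 ≤ d) {m n : ℕ} (h : m ≠ n) :
    inner ℂ (laguerreVec hd m) (laguerreVec hd n) = 0 := by
  exact (inner_laguerreVec_toLp hd m (memLp_laguerreL hd n)).trans
    (integral_laguerreL_mul_laguerreL_eq_zero hd h)

theorem inner_laguerreVec_expVec {d : ℕ} (hd : 1 ≤ d) {σ : ℂ} (hσ : 0 < 1 + 2 * σ.re) (n : ℕ) :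
    inner ℂ (laguerreVec hd n) (expVec hd hσ) =
      ((∏ j ∈ Finset.Ioc 0 n, ((d : ℝ) / 2 - 1 + (j : ℝ)) : ℝ) : ℂ) / (n.factorial : ℂ) *
        ((1 / (1 + σ)) ^ ((d : ℂ) / 2) * (σ / (1 + σ)) ^ n) := by
  rw [expVec, inner_laguerreVec_toLp, integral_laguerreL_mul_cexp hd]
  rw [Complex.add_re, Complex.one_re]; linarith

theorem laguerreVec_ne_zero {d : ℕ} (hd : 1 ≤ d) (n : ℕ) : laguerreVec hd n ≠ 0 := by
  intro h
  have hd' : (0 : ℝ) < d := by exact_mod_cast hd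
  have h1 := inner_laguerreVec_expVec hd (σ := 1) (by simp; norm_num) n
  have hP : ((∏ j ∈ Finset.Ioc 0 n, ((d : ℝ) / 2 - 1 + (j : ℝ)) : ℝ) : ℂ) ≠ 0 := by
    exact_mod_cast (prod_Ioc_add_natCast_pos (by simpa) 0 n).ne'
  rw [h, inner_zero_left, eq_comm] at h1
  refine mul_ne_zero (div_ne_zero hP (by exact_mod_cast n.factorial_ne_zero))
    (mul_ne_zero ?_ (pow_ne_zero _ ?_)) h1
  · rw [Complex.cpow_ne_zero_iff_of_exponent_ne_zero (by simp; omega)]; norm_num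
  · norm_num

theorem eq_top_of_laguerreVec_mem {d : ℕ} (hd : 1 ≤ d)
    {V : Submodule ℂ (LaguerreL2 ((d : ℝ) / 2 - 1))} (hV : IsClosed (V : Set (LaguerreL2 ((d : ℝ) / 2 - 1))))
    (h : ∀ n, laguerreVec hd n ∈ V) : V = ⊤ :=
  eq_top_of_forall_aemem_laguerreL hd hV fun n => ⟨_, h n, coeFn_laguerreVec hd n⟩

theorem eq_of_inner_laguerreVec_eq {d : ℕ} (hd : 1 ≤ d) {u v : LaguerreL2 ((d : ℝ) / 2 - 1)}
    (h : ∀ n, inner ℂ (laguerreVec hd n) u = inner ℂ (laguerreVec hd n) v) : u = v := by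
  have hV : (ℂ ∙ (u - v))ᗮ = ⊤ :=
    eq_top_of_laguerreVec_mem hd (Submodule.isClosed_orthogonal _) fun n => by
      rw [Submodule.mem_orthogonal_singleton_iff_inner_left, inner_sub_right, h n, sub_self]
  have : u - v ∈ (ℂ ∙ (u - v))ᗮ := by rw [hV]; trivial
  rw [Submodule.mem_orthogonal_singleton_iff_inner_left, inner_self_eq_zero] at this
  exact sub_eq_zero.1 this

theorem continuousLinearMap_ext_laguerreVec {d : ℕ} (hd : 1 ≤ d) {E : Type*}
    [NormedAddCommGroup E] [NormedSpace ℂ E] {A B : LaguerreL2 ((d : ℝ) / 2 - 1) →L[ℂ] E}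
    (h : ∀ n, A (laguerreVec hd n) = B (laguerreVec hd n)) : A = B := by
  have := eq_top_of_laguerreVec_mem hd (V := (A - B).ker) (A - B).isClosed_ker fun n => by
    simp [h n]
  ext1 u
  have hu : u ∈ (A - B).ker := by rw [this]; trivial
  exact sub_eq_zero.1 (by simpa using hu)

theorem continuousLinearMap_ext_expVec {d : ℕ} (hd : 1 ≤ d) {E : Type*}
    [NormedAddCommGroup E] [NormedSpace ℂ E] {A B : LaguerreL2 ((d : ℝ) / 2 - 1) →L[ℂ] E}
    (h : ∀ (σ : ℝ) (hσ : 0 ≤ σ), A (expVec hd (σ := σ) (by rw [Complex.ofReal_re]; linarith)) =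
      B (expVec hd (σ := σ) (by rw [Complex.ofReal_re]; linarith))) : A = B := by
  have := eq_top_of_forall_aemem_exp hd (V := (A - B).ker) (A - B).isClosed_ker fun k => by
    have hk : 0 < 1 + 2 * ((k / 4 : ℝ) : ℂ).re := by rw [Complex.ofReal_re]; positivity
    exact ⟨expVec hd hk, sub_eq_zero.2 (h (k / 4) (by positivity)),
      (memLp_cexp hd hk).coeFn_toLp⟩
  ext1 u
  have hu : u ∈ (A - B).ker := by rw [this]; trivial
  exact sub_eq_zero.1 (by simpa using hu)

theorem orthonormal_laguerreVec {d : ℕ} (hd : 1 ≤ d) {κ : ℂ} (hκ : ‖κ‖ = 1) :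
    Orthonormal ℂ fun n => ((κ ^ n / ‖laguerreVec hd n‖ : ℂ)) • laguerreVec hd n := by
  refine ⟨fun n => ?_, fun m n hmn => ?_⟩
  · have := norm_ne_zero_iff.2 (laguerreVec_ne_zero hd n)
    rw [norm_smul, norm_div, norm_pow, hκ, one_pow, Complex.norm_real, norm_norm]
    field_simp
  · simp only [inner_smul_left, inner_smul_right, inner_laguerreVec_laguerreVec hd hmn, mul_zero]

/-- The normalized Laguerre vectors form a Hilbert basis, and so do their multiples by `κ^n`; `M`
carries the first basis to the second. The value of `‖L_n‖` is never needed. -/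
theorem exists_phaseOperator {d : ℕ} (hd : 1 ≤ d) {κ : ℂ} (hκ : ‖κ‖ = 1) :
    ∃ M : LaguerreL2 ((d : ℝ) / 2 - 1) →L[ℂ] LaguerreL2 ((d : ℝ) / 2 - 1),
      ∀ n, M (laguerreVec hd n) = κ ^ n • laguerreVec hd n := by
  have hb (κ : ℂ) (hκ : ‖κ‖ = 1) : ∃ b : HilbertBasis ℕ ℂ (LaguerreL2 ((d : ℝ) / 2 - 1)),
      ∀ n, b n = ((κ ^ n / ‖laguerreVec hd n‖ : ℂ)) • laguerreVec hd n := by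
    refine ⟨HilbertBasis.mk (orthonormal_laguerreVec hd hκ) (eq_top_of_laguerreVec_mem hd
      (Submodule.isClosed_topologicalClosure _) fun n => ?_).ge, fun n => by
        rw [HilbertBasis.coe_mk]⟩
    have hn : (‖laguerreVec hd n‖ : ℂ) ≠ 0 := by
      exact_mod_cast norm_ne_zero_iff.2 (laguerreVec_ne_zero hd n)
    have hκ0 : κ ≠ 0 := by rintro rfl; simp at hκ
    have e : laguerreVec hd n = (‖laguerreVec hd n‖ / κ ^ n : ℂ) •
        (κ ^ n / ‖laguerreVec hd n‖ : ℂ) • laguerreVec hd n := by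
      rw [smul_smul, div_mul_div_comm, mul_comm, div_self (by positivity), one_smul]
    rw [e]
    exact Submodule.smul_mem _ _ (Submodule.le_topologicalClosure _
      (Submodule.subset_span ⟨n, rfl⟩))
  obtain ⟨b, hb1⟩ := hb 1 (by simp)
  obtain ⟨b', hb2⟩ := hb κ hκ
  refine ⟨(b.repr.trans b'.repr.symm).toContinuousLinearEquiv.toContinuousLinearMap, fun n => ?_⟩
  have hn : (‖laguerreVec hd n‖ : ℂ) ≠ 0 := by
    exact_mod_cast norm_ne_zero_iff.2 (laguerreVec_ne_zero hd n)
  have e : laguerreVec hd n = (‖laguerreVec hd n‖ : ℂ) • b n := by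
    rw [hb1, smul_smul, one_pow, mul_one_div_cancel hn, one_smul]
  have e' : (b.repr.trans b'.repr.symm) (b n) = b' n := by
    rw [LinearIsometryEquiv.trans_apply, HilbertBasis.repr_self, HilbertBasis.repr_symm_single]
  nth_rewrite 1 [e]
  rw [map_smul]
  change (‖laguerreVec hd n‖ : ℂ) • (b.repr.trans b'.repr.symm) (b n) = _
  rw [e', hb2, smul_smul, mul_div_cancel₀ _ hn]

/-- Multiplying the `n`-th Laguerre coefficient of `e^{-σx}` by `κ^n` only changes the ratio
`σ/(1+σ)` of the geometric sequence, so the result is again an exponential up to a factor. -/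
theorem phaseOperator_expVec {d : ℕ} (hd : 1 ≤ d) {κ : ℂ}
    {M : LaguerreL2 ((d : ℝ) / 2 - 1) →L[ℂ] LaguerreL2 ((d : ℝ) / 2 - 1)}
    (hM : ∀ n, M (laguerreVec hd n) = κ ^ n • laguerreVec hd n) {σ σ' K : ℂ}
    (hσ : 0 < 1 + 2 * σ.re) (hσ' : 0 < 1 + 2 * σ'.re)
    (h : σ' / (1 + σ') = κ * (σ / (1 + σ)))
    (hK : K * (1 / (1 + σ')) ^ ((d : ℂ) / 2) = (1 / (1 + σ)) ^ ((d : ℂ) / 2)) :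
    M (expVec hd hσ) = K • expVec hd hσ' := by
  refine eq_of_inner_laguerreVec_eq hd fun n => ?_
  have hcoef : (innerSL ℂ (laguerreVec hd n)) ∘L M = κ ^ n • innerSL ℂ (laguerreVec hd n) := by
    refine continuousLinearMap_ext_laguerreVec hd fun m => ?_
    rw [ContinuousLinearMap.comp_apply, hM, _root_.smul_apply, map_smul,
      innerSL_apply_apply]
    rcases eq_or_ne n m with rfl | hnm
    · rfl
    · rw [inner_laguerreVec_laguerreVec hd hnm, smul_zero, smul_zero]
  have h1 := congrArg (fun A => A (expVec hd hσ)) hcoef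
  simp only [ContinuousLinearMap.comp_apply, _root_.smul_apply,
    innerSL_apply_apply] at h1
  rw [h1, inner_smul_right, inner_laguerreVec_expVec, inner_laguerreVec_expVec, h, ← hK,
    mul_pow, smul_eq_mul]
  ring

theorem exists_dilation {d : ℕ} (hd : 1 ≤ d) {c : ℝ} (hc : 0 < c) (hc1 : c ≤ 1) :
    ∃ D : LaguerreL2 ((d : ℝ) / 2 - 1) →L[ℂ] LaguerreL2 ((d : ℝ) / 2 - 1),
      (∀ h, D h =ᵐ[laguerreMeasure ((d : ℝ) / 2 - 1)] fun x => h (c * x)) ∧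
      ∀ h h' : ℝ → ℂ, h =ᵐ[laguerreMeasure ((d : ℝ) / 2 - 1)] h' →
        (fun x => h (c * x)) =ᵐ[laguerreMeasure ((d : ℝ) / 2 - 1)] fun x => h' (c * x) := by
  have hC : ((laguerreMeasure ((d : ℝ) / 2 - 1)).withDensity
      fun _ : ℝ => ‖(1 : ℂ)‖ₑ ^ 2).map (fun x => c * x) ≤
      ENNReal.ofReal ((Real.pi / (c * Real.pi)) ^ ((d : ℝ) / 2)) •
        laguerreMeasure ((d : ℝ) / 2 - 1) := by
    rw [← map_gaussian_eq_laguerreMeasure hd (by positivity)]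
    simp only [enorm_one, one_pow]
    rw [show (fun _ : ℝ => (1 : ENNReal)) = 1 from rfl, withDensity_one,
      laguerreMeasure_eq_map hd, Measure.map_map (by fun_prop) (by fun_prop)]
    have e : ((fun x => c * x) ∘ fun x : EuclideanSpace ℝ (Fin d) => Real.pi * ‖x‖ ^ 2) =
        fun x => c * Real.pi * ‖x‖ ^ 2 := by ext x; simp [mul_assoc]
    rw [e]
    -- Boundedness uses `c ≤ 1`: the Gaussian of rate `π` lies below that of rate `cπ`, whose image
    -- is a multiple of the Laguerre measure.
    refine Measure.map_mono (withDensity_mono (Eventually.of_forall fun x => ?_)) (by fun_prop)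
    refine ENNReal.ofReal_le_ofReal (Real.exp_le_exp.2 (neg_le_neg ?_))
    rw [mul_assoc]
    exact mul_le_of_le_one_left (by positivity) hc1
  obtain ⟨D, hD⟩ := exists_weighted_comp (measurable_const_mul c) (w := fun _ => (1 : ℂ))
    measurable_const ENNReal.ofReal_ne_top hC
  refine ⟨D, fun h => by simpa using hD h, fun h h' hh => ?_⟩
  simpa using weighted_comp_congr_ae (measurable_const_mul c) (w := fun _ => (1 : ℂ))
    measurable_const hC hh

theorem IsLaguerreOperator.unique {d : ℕ} (hd : 1 ≤ d) {p t : ℝ}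
    {T T' : LaguerreL2 ((d : ℝ) / 2 - 1) →L[ℂ] LaguerreL2 ((d : ℝ) / 2 - 1)}
    (hT : IsLaguerreOperator ((d : ℝ) / 2 - 1) p t T)
    (hT' : IsLaguerreOperator ((d : ℝ) / 2 - 1) p t T') : T = T' := by
  refine continuousLinearMap_ext_laguerreVec hd fun n => ?_
  obtain ⟨u, hu, hTu⟩ := hT n
  obtain ⟨u', hu', hTu'⟩ := hT' n
  have e : u = laguerreVec hd n :=
    Lp.ext (EventuallyEq.trans hu (coeFn_laguerreVec hd n).symm)
  have e' : u' = laguerreVec hd n :=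
    Lp.ext (EventuallyEq.trans hu' (coeFn_laguerreVec hd n).symm)
  subst e
  rw [e'] at hTu'
  exact Lp.ext (EventuallyEq.trans hTu (EventuallyEq.symm hTu'))

theorem norm_cexp_two_pi_I_mul (t : ℝ) : ‖Complex.exp (2 * Real.pi * Complex.I * t)‖ = 1 := by
  rw [show (2 * Real.pi * Complex.I * t : ℂ) = ((2 * Real.pi * t : ℝ) : ℂ) * Complex.I by
    push_cast; ring, Complex.norm_exp_ofReal_mul_I]

theorem isLaguerreOperator_dilation_comp {d : ℕ} (hd : 1 ≤ d) {p t : ℝ}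
    {D M : LaguerreL2 ((d : ℝ) / 2 - 1) →L[ℂ] LaguerreL2 ((d : ℝ) / 2 - 1)}
    (hD : (∀ h, D h =ᵐ[laguerreMeasure ((d : ℝ) / 2 - 1)] fun x => h (2 / p * x)) ∧
      ∀ h h' : ℝ → ℂ, h =ᵐ[laguerreMeasure ((d : ℝ) / 2 - 1)] h' →
        (fun x => h (2 / p * x)) =ᵐ[laguerreMeasure ((d : ℝ) / 2 - 1)] fun x => h' (2 / p * x))
    (hM : ∀ n, M (laguerreVec hd n) =
      Complex.exp (2 * Real.pi * Complex.I * t) ^ n • laguerreVec hd n) :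
    IsLaguerreOperator ((d : ℝ) / 2 - 1) p t (D ∘L M) := by
  intro n
  refine ⟨laguerreVec hd n, coeFn_laguerreVec hd n, ?_⟩
  rw [ContinuousLinearMap.comp_apply, hM, map_smul]
  filter_upwards [Lp.coeFn_smul (Complex.exp (2 * Real.pi * Complex.I * t) ^ n)
    (D (laguerreVec hd n)), hD.1 (laguerreVec hd n), hD.2 _ _ (coeFn_laguerreVec hd n)]
    with x h1 h2 h3
  rw [h1, Pi.smul_apply, h2, h3, smul_eq_mul, ← Complex.exp_nat_mul]
  congr 2; ring

/-! ### The lens transform and the Schrödinger flow -/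

/-- The weight `(1 + is)^{-d/2} e^{-π‖x‖²/(1 + is)}` of the lens transform. -/
noncomputable def lensWeight (d : ℕ) (s : ℝ) (x : EuclideanSpace ℝ (Fin d)) : ℂ :=
  (1 + s * Complex.I) ^ (-((d : ℂ) / 2)) * complexGaussian d (1 / (1 + s * Complex.I)) x

theorem measurable_lensWeight (d : ℕ) (s : ℝ) : Measurable (lensWeight d s) :=
  (measurable_complexGaussian d _).const_mul _

theorem norm_lensWeight (d : ℕ) (s : ℝ) (x : EuclideanSpace ℝ (Fin d)) :
    ‖lensWeight d s x‖ =
      (1 + s ^ 2) ^ (-((d : ℝ) / 4)) * Real.exp (-(Real.pi / (1 + s ^ 2) * ‖x‖ ^ 2)) := by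
  have hn : ‖(1 + s * Complex.I : ℂ)‖ = (1 + s ^ 2) ^ (1 / 2 : ℝ) := by
    rw [← Real.sqrt_eq_rpow, Complex.norm_def, Complex.normSq_apply]
    congr 1; simp; ring
  rw [lensWeight, norm_mul, complexGaussian, Complex.norm_exp]
  congr 1
  · rw [show (-((d : ℂ) / 2)) = ((-((d : ℝ) / 2) : ℝ) : ℂ) by push_cast; ring,
      Complex.norm_cpow_real, hn, ← Real.rpow_mul (by positivity)]
    congr 1; ring
  · have h1 : (1 + s ^ 2 : ℝ) ≠ 0 := by positivity
    have hz : (1 / (1 + s * Complex.I) : ℂ).re = 1 / (1 + s ^ 2) := by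
      rw [one_div, Complex.inv_re, Complex.normSq_apply]
      simp; ring
    rw [← Complex.ofReal_pow, Complex.re_mul_ofReal, Complex.neg_re, Complex.re_ofReal_mul, hz]
    congr 1; ring

/-- The `p`-th power of the weight is a Gaussian of rate `a = pπ/(1+s²)`, and the lens variable is
`(2/p) a‖x‖²`. This is where the dilation by `2/p` comes from. -/
theorem map_lensWeight_rpow {d : ℕ} (hd : 1 ≤ d) (s : ℝ) {p : ℝ} (hp : 0 < p) :
    ((volume : Measure (EuclideanSpace ℝ (Fin d))).withDensity
      fun x => ‖lensWeight d s x‖ₑ ^ p).map (fun x => 2 * Real.pi / (1 + s ^ 2) * ‖x‖ ^ 2) =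
    ENNReal.ofReal ((1 + s ^ 2) ^ ((d : ℝ) / 2 - d * p / 4) * p ^ (-((d : ℝ) / 2))) •
      (laguerreMeasure ((d : ℝ) / 2 - 1)).map (fun x => 2 / p * x) := by
  have hs : (0 : ℝ) < 1 + s ^ 2 := by positivity
  have h1 : (fun x : EuclideanSpace ℝ (Fin d) => ‖lensWeight d s x‖ₑ ^ p) =
      ENNReal.ofReal ((1 + s ^ 2) ^ (-((d : ℝ) * p / 4))) •
        fun x => ENNReal.ofReal (Real.exp (-(p * Real.pi / (1 + s ^ 2) * ‖x‖ ^ 2))) := by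
    ext x
    rw [Pi.smul_apply, smul_eq_mul, ← ofReal_norm, norm_lensWeight,
      ENNReal.ofReal_rpow_of_nonneg (by positivity) hp.le, ← ENNReal.ofReal_mul (by positivity),
      Real.mul_rpow (by positivity) (by positivity), ← Real.rpow_mul hs.le, ← Real.exp_mul]
    congr 3 <;> ring
  have h2 : (fun x : EuclideanSpace ℝ (Fin d) => 2 * Real.pi / (1 + s ^ 2) * ‖x‖ ^ 2) =
      (fun x => 2 / p * x) ∘ fun x => p * Real.pi / (1 + s ^ 2) * ‖x‖ ^ 2 := by
    ext x; simp only [Function.comp_apply]; field_simp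
  rw [h1, withDensity_smul _ (by fun_prop), h2, ← Measure.map_map (by fun_prop) (by fun_prop),
    Measure.map_smul, map_gaussian_eq_laguerreMeasure hd (by positivity), Measure.map_smul,
    Measure.map_smul, smul_smul, ← ENNReal.ofReal_mul (by positivity)]
  congr 2
  have e : Real.pi / (p * Real.pi / (1 + s ^ 2)) = (1 + s ^ 2) * p⁻¹ := by
    field_simp
  rw [e, Real.mul_rpow (by positivity) (by positivity), ← mul_assoc, ← Real.rpow_add hs,
    Real.inv_rpow hp.le, ← Real.rpow_neg hp.le]
  congr 2; ring

/-- At `p = 2` the power of `1 + s²` and the dilation both disappear, so the lens operator scales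
norms by the same factor at every time. -/
theorem map_lensWeight_sq {d : ℕ} (hd : 1 ≤ d) (s : ℝ) :
    ((volume : Measure (EuclideanSpace ℝ (Fin d))).withDensity
      fun x => ‖lensWeight d s x‖ₑ ^ 2).map (fun x => 2 * Real.pi / (1 + s ^ 2) * ‖x‖ ^ 2) =
    ENNReal.ofReal (2 ^ (-((d : ℝ) / 2))) • laguerreMeasure ((d : ℝ) / 2 - 1) := by
  have h := map_lensWeight_rpow hd s (p := 2) (by norm_num)
  simp only [ENNReal.rpow_ofNat, div_self (two_ne_zero (α := ℝ)), one_mul, Measure.map_id'] at h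
  rw [h, show (d : ℝ) / 2 - d * 2 / 4 = 0 by ring, Real.rpow_zero, one_mul]

theorem exists_lensOperator {d : ℕ} (hd : 1 ≤ d) (s : ℝ) :
    ∃ W : LaguerreL2 ((d : ℝ) / 2 - 1) →L[ℂ] SpaceL2 d, ∀ h, W h =ᵐ[volume]
      fun x => lensWeight d s x * h (2 * Real.pi / (1 + s ^ 2) * ‖x‖ ^ 2) :=
  exists_weighted_comp (by fun_prop) (measurable_lensWeight d s) ENNReal.ofReal_ne_top
    (map_lensWeight_sq hd s).le

theorem lensOperator_expVec {d : ℕ} (hd : 1 ≤ d) {s : ℝ}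
    {W : LaguerreL2 ((d : ℝ) / 2 - 1) →L[ℂ] SpaceL2 d}
    (hW : ∀ h, W h =ᵐ[volume]
      fun x => lensWeight d s x * h (2 * Real.pi / (1 + s ^ 2) * ‖x‖ ^ 2))
    {σ z : ℂ} (hσ : 0 < 1 + 2 * σ.re) (hz : 0 < z.re)
    (h : 1 / (1 + s * Complex.I) + 2 * σ / (1 + s ^ 2) = z) :
    W (expVec hd hσ) =
      (1 + s * Complex.I) ^ (-((d : ℂ) / 2)) • (memLp_complexGaussian d hz).toLp _ := by
  apply Lp.ext
  filter_upwards [hW (expVec hd hσ),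
    weighted_comp_congr_ae (by fun_prop) (measurable_lensWeight d s) (map_lensWeight_sq hd s).le
      (memLp_cexp hd hσ).coeFn_toLp,
    Lp.coeFn_smul ((1 + s * Complex.I) ^ (-((d : ℂ) / 2))) ((memLp_complexGaussian d hz).toLp _),
    (memLp_complexGaussian d hz).coeFn_toLp] with x h1 h2 h3 h4
  rw [h1, expVec, h2, h3, Pi.smul_apply, h4, smul_eq_mul, lensWeight, mul_assoc, complexGaussian,
    complexGaussian, ← Complex.exp_add, ← h]
  congr 2
  push_cast
  ring

theorem schrodinger_lensOperator {d : ℕ} (hd : 1 ≤ d) {t s : ℝ} (hs : s = 4 * Real.pi * t)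
    {J W : LaguerreL2 ((d : ℝ) / 2 - 1) →L[ℂ] SpaceL2 d}
    (hJ : ∀ h, J h =ᵐ[volume]
      fun x => lensWeight d 0 x * h (2 * Real.pi / (1 + 0 ^ 2) * ‖x‖ ^ 2))
    (hW : ∀ h, W h =ᵐ[volume]
      fun x => lensWeight d s x * h (2 * Real.pi / (1 + s ^ 2) * ‖x‖ ^ 2))
    {M : LaguerreL2 ((d : ℝ) / 2 - 1) →L[ℂ] LaguerreL2 ((d : ℝ) / 2 - 1)}
    (hM : ∀ n, M (laguerreVec hd n) =
      ((1 - s * Complex.I) / (1 + s * Complex.I)) ^ n • laguerreVec hd n)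
    (h : LaguerreL2 ((d : ℝ) / 2 - 1)) : schrodinger t (J h) = W (M h) := by
  obtain ⟨S, hS⟩ := exists_continuousLinearMap_eq_schrodinger d t
  rw [← hS]
  suffices H : S ∘L J = W ∘L M from congrArg (fun A => A h) H
  refine continuousLinearMap_ext_expVec hd fun σ hσ => ?_
  rw [ContinuousLinearMap.comp_apply, ContinuousLinearMap.comp_apply, hS]
  set a : ℂ := 1 + s * Complex.I with ha
  have hare : a.re = 1 := by simp [ha]
  have ha0 : a ≠ 0 := by intro h; simp [h] at hare
  have hzpos : 0 < 1 + 2 * σ := by positivity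
  -- With `z = 1 + 2σ` the evolved Gaussian has parameter `z' = z/b`, since `1/z' = 1/z + is`.
  set b : ℂ := 1 + s * Complex.I * ((1 + 2 * σ : ℝ) : ℂ) with hb
  have hbre : b.re = 1 := by simp [hb]
  have hb0 : b ≠ 0 := by intro h; simp [h] at hbre
  have hz : 0 < (((1 + 2 * σ : ℝ) : ℂ)).re := by rwa [Complex.ofReal_re]
  have hz0 : (((1 + 2 * σ : ℝ) : ℂ)) ≠ 0 := by exact_mod_cast hzpos.ne'
  have hzinv : 0 < (1 / ((1 + 2 * σ : ℝ) : ℂ)).re := re_one_div_pos hz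
  have hσ1 : (1 + σ : ℂ) ≠ 0 := by
    have : (0 : ℝ) < 1 + σ := by positivity
    exact_mod_cast this.ne'
  have hσ1re : 0 < (1 / (1 + σ : ℂ)).re := re_one_div_pos (by simp; positivity)
  have hz' : 0 < ((((1 + 2 * σ : ℝ) : ℂ)) / b).re := by
    rw [Complex.div_re, hbre, Complex.ofReal_re, Complex.ofReal_im]
    have := Complex.normSq_pos.2 hb0
    rw [zero_mul, zero_div, add_zero, mul_one]
    positivity
  have hconj : (1 - s * Complex.I) * a = 1 + s ^ 2 := by
    rw [ha]; linear_combination (-(s : ℂ) ^ 2) * Complex.I_sq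
  have hs2 : (1 + s ^ 2 : ℂ) ≠ 0 := by
    have : (0 : ℝ) < 1 + s ^ 2 := by positivity
    exact_mod_cast this.ne'
  -- The solution of `σ'/(1+σ') = κσ/(1+σ)`; `hlens` says that the lens transform of `e^{-σ'x}` is a
  -- multiple of the Gaussian of parameter `z'`.
  set σ' : ℂ := σ * (1 - s * Complex.I) / b with hσ'
  have hσ'1 : 1 + σ' = a * (1 + σ) / b := by
    rw [hσ', eq_div_iff hb0, add_mul, div_mul_cancel₀ _ hb0, hb, ha]; push_cast; ring
  have hlens : 1 / a + 2 * σ' / (1 + s ^ 2) = ((1 + 2 * σ : ℝ) : ℂ) / b := by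
    rw [← hconj, hσ']
    have hc0 : (1 - s * Complex.I : ℂ) ≠ 0 := by
      intro h; rw [h, zero_mul] at hconj; exact hs2 hconj.symm
    field_simp
    rw [hb, ha]; push_cast; ring
  -- Taking real parts in `hlens` gives `1 + 2 Re σ' = (1+s²) Re z'`, because `Re (1/a) = 1/(1+s²)`.
  have hσ're : 0 < 1 + 2 * σ'.re := by
    have e : σ' = (((1 + 2 * σ : ℝ) : ℂ) / b - 1 / a) * ((1 + s ^ 2 : ℝ) : ℂ) / 2 := by
      rw [← hlens]; push_cast; field_simp; ring
    have h1 : (1 / a).re = 1 / (1 + s ^ 2) := by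
      rw [one_div, Complex.inv_re, Complex.normSq_apply, ha]
      simp; ring
    have e2 : 2 * σ'.re = ((((1 + 2 * σ : ℝ) : ℂ) / b).re - (1 / a).re) * (1 + s ^ 2) := by
      rw [← Complex.sub_re, ← Complex.re_mul_ofReal, e, Complex.div_ofNat_re]; ring
    have h3 : (0 : ℝ) < 1 + s ^ 2 := by positivity
    rw [e2, h1, sub_mul, one_div_mul_cancel h3.ne']
    have := mul_pos hz' h3
    linarith
  have hσ'1re : 0 < (1 / (1 + σ')).re := by
    refine re_one_div_pos ?_
    rw [Complex.add_re, Complex.one_re]; linarith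
  have hJσ := lensOperator_expVec hd hJ (σ := σ) (z := ((1 + 2 * σ : ℝ) : ℂ))
    (by rw [Complex.ofReal_re]; positivity) hz (by simp)
  have hbpow : b ^ ((d : ℂ) / 2) ≠ 0 := by simp [Complex.cpow_eq_zero_iff, hb0]
  have hapow : a ^ ((d : ℂ) / 2) ≠ 0 := by simp [Complex.cpow_eq_zero_iff, ha0]
  have hS' := schrodinger_complexGaussian d t hz hz' (c := b ^ (-((d : ℂ) / 2)))
    (by rw [one_div_div, hb, hs]; field_simp; push_cast; ring)
    (by
      rw [one_div_div, div_eq_mul_one_div b, cpow_mul_of_re_pos (by rw [hbre]; exact one_pos) hzinv,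
        Complex.cpow_neg, inv_mul_cancel_left₀ hbpow])
  -- The factor `a^{d/2}` in `K` cancels the prefactor `(1+is)^{-d/2}` of the lens weight. The
  -- powers split because all four bases in `a · 1/(1+σ') = 1/(1+σ) · b` have positive real part.
  have hMσ := phaseOperator_expVec hd hM (σ := σ) (σ' := σ')
    (K := a ^ ((d : ℂ) / 2) * b ^ (-((d : ℂ) / 2)))
    (by rw [Complex.ofReal_re]; positivity) hσ're
    (by rw [hσ'1, hσ']; field_simp)
    (by
      rw [mul_right_comm, ← cpow_mul_of_re_pos (by rw [hare]; exact one_pos) hσ'1re,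
        show a * (1 / (1 + σ')) = 1 / (1 + σ) * b by rw [hσ'1]; field_simp,
        cpow_mul_of_re_pos hσ1re (by rw [hbre]; exact one_pos), Complex.cpow_neg,
        mul_inv_cancel_right₀ hbpow])
  have hWσ := lensOperator_expVec hd hW hσ're hz' hlens
  rw [hJσ, hMσ, map_smul, hWσ, smul_smul]
  simp only [Complex.ofReal_zero, zero_mul, add_zero, Complex.one_cpow, one_smul]
  rw [hS', ← ha, Complex.cpow_neg a]
  congr 1
  field_simp

theorem lintegral_lensWeight_mul {d : ℕ} (hd : 1 ≤ d) (s : ℝ) {p : ℝ} (hp : 0 < p) {h : ℝ → ℂ}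
    (hh : Measurable h) :
    ∫⁻ x : EuclideanSpace ℝ (Fin d),
        ‖lensWeight d s x * h (2 * Real.pi / (1 + s ^ 2) * ‖x‖ ^ 2)‖ₑ ^ p =
      ENNReal.ofReal ((1 + s ^ 2) ^ ((d : ℝ) / 2 - d * p / 4) * p ^ (-((d : ℝ) / 2))) *
        ∫⁻ x, ‖h (2 / p * x)‖ₑ ^ p ∂laguerreMeasure ((d : ℝ) / 2 - 1) := by
  have hw := measurable_lensWeight d s
  have e1 : ∫⁻ x : EuclideanSpace ℝ (Fin d),
        ‖lensWeight d s x * h (2 * Real.pi / (1 + s ^ 2) * ‖x‖ ^ 2)‖ₑ ^ p =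
      ∫⁻ y, ‖h y‖ₑ ^ p ∂(((volume : Measure (EuclideanSpace ℝ (Fin d))).withDensity
        fun x => ‖lensWeight d s x‖ₑ ^ p).map (fun x => 2 * Real.pi / (1 + s ^ 2) * ‖x‖ ^ 2)) := by
    rw [lintegral_map (by fun_prop) (by fun_prop),
      lintegral_withDensity_eq_lintegral_mul _ (by fun_prop) (by fun_prop)]
    refine lintegral_congr fun x => ?_
    rw [Pi.mul_apply, enorm_mul, ENNReal.mul_rpow_of_nonneg _ _ hp.le]
  rw [e1, map_lensWeight_rpow hd s hp, lintegral_smul_measure, smul_eq_mul,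
    lintegral_map (by fun_prop) (by fun_prop)]

theorem enorm_lensOperator {d : ℕ} (hd : 1 ≤ d) {s : ℝ}
    {W : LaguerreL2 ((d : ℝ) / 2 - 1) →L[ℂ] SpaceL2 d}
    (hW : ∀ h, W h =ᵐ[volume]
      fun x => lensWeight d s x * h (2 * Real.pi / (1 + s ^ 2) * ‖x‖ ^ 2))
    (h : LaguerreL2 ((d : ℝ) / 2 - 1)) :
    ‖W h‖ₑ = ENNReal.ofReal (2 ^ (-((d : ℝ) / 4))) * ‖h‖ₑ := by
  rw [Lp.enorm_def, Lp.enorm_def, eLpNorm_congr_ae (hW h),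
    eLpNorm_eq_lintegral_rpow_enorm_toReal (by simp) (by simp),
    eLpNorm_eq_lintegral_rpow_enorm_toReal (by simp) (by simp), ENNReal.toReal_ofNat,
    lintegral_lensWeight_mul hd s two_pos (Lp.stronglyMeasurable h).measurable,
    ENNReal.mul_rpow_of_nonneg _ _ (by norm_num), ENNReal.ofReal_rpow_of_nonneg (by positivity)
      (by norm_num), show (d : ℝ) / 2 - d * 2 / 4 = 0 by ring, Real.rpow_zero, one_mul,
    ← Real.rpow_mul (by norm_num)]
  simp only [div_self (two_ne_zero (α := ℝ)), one_mul]
  congr 3; ring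

theorem norm_lensOperator {d : ℕ} (hd : 1 ≤ d) {s : ℝ}
    {W : LaguerreL2 ((d : ℝ) / 2 - 1) →L[ℂ] SpaceL2 d}
    (hW : ∀ h, W h =ᵐ[volume]
      fun x => lensWeight d s x * h (2 * Real.pi / (1 + s ^ 2) * ‖x‖ ^ 2))
    (h : LaguerreL2 ((d : ℝ) / 2 - 1)) : ‖W h‖ = 2 ^ (-((d : ℝ) / 4)) * ‖h‖ := by
  have := congrArg ENNReal.toReal (enorm_lensOperator hd hW h)
  rwa [ENNReal.toReal_mul, toReal_enorm, toReal_enorm, ENNReal.toReal_ofReal (by positivity)]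
    at this

theorem lensOperator_laguerreVec {d : ℕ} (hd : 1 ≤ d)
    {J : LaguerreL2 ((d : ℝ) / 2 - 1) →L[ℂ] SpaceL2 d}
    (hJ : ∀ h, J h =ᵐ[volume]
      fun x => lensWeight d 0 x * h (2 * Real.pi / (1 + 0 ^ 2) * ‖x‖ ^ 2)) (n : ℕ) :
    J (laguerreVec hd n) =ᵐ[volume] fun x => (radialPsi d n x : ℂ) := by
  filter_upwards [hJ (laguerreVec hd n), weighted_comp_congr_ae (by fun_prop)
    (measurable_lensWeight d 0) (map_lensWeight_sq hd 0).le (coeFn_laguerreVec hd n)] with x h1 h2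
  rw [h1, h2, lensWeight, complexGaussian, radialPsi]
  simp [mul_comm]

theorem eLpNorm_sub_sum_eq_enorm {X : Type*} [MeasurableSpace X] {μ : Measure X}
    {φ : ℕ → X → ℝ} {v : ℕ → Lp ℂ 2 μ} (hv : ∀ n, v n =ᵐ[μ] fun x => (φ n x : ℂ)) (α : ℕ → ℂ)
    (f : Lp ℂ 2 μ) (N : ℕ) :
    eLpNorm (fun x => f x - ∑ n ∈ Finset.range N, α n * (φ n x : ℂ)) 2 μ =
      ‖f - ∑ n ∈ Finset.range N, α n • v n‖ₑ := by
  rw [Lp.enorm_def]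
  refine eLpNorm_congr_ae ?_
  have hs : ∀ n, ⇑(α n • v n) =ᵐ[μ] fun x => α n * (φ n x : ℂ) := fun n => by
    filter_upwards [Lp.coeFn_smul (α n) (v n), hv n] with x h1 h2
    rw [h1, Pi.smul_apply, h2, smul_eq_mul]
  filter_upwards [Lp.coeFn_sub f (∑ n ∈ Finset.range N, α n • v n),
    Lp.coeFn_finsetSum (Finset.range N) (fun n => α n • v n), ae_all_iff.2 hs] with x h1 h2 h3
  rw [h1, Pi.sub_apply, h2, Finset.sum_apply]
  simp only [h3]

/-- Being a multiple of an isometry, `J` has closed range. Hence the limit `f` of the images of the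
partial sums is some `J g`, and the errors in the two expansions are proportional. -/
theorem exists_isL2Expansion_laguerreL {d : ℕ} (hd : 1 ≤ d)
    {J : LaguerreL2 ((d : ℝ) / 2 - 1) →L[ℂ] SpaceL2 d}
    (hJ : ∀ h, J h =ᵐ[volume]
      fun x => lensWeight d 0 x * h (2 * Real.pi / (1 + 0 ^ 2) * ‖x‖ ^ 2))
    {f : SpaceL2 d} {α : ℕ → ℂ} (hf : IsL2Expansion volume (radialPsi d) α f) :
    ∃ g : LaguerreL2 ((d : ℝ) / 2 - 1), J g = f ∧
      IsL2Expansion (laguerreMeasure ((d : ℝ) / 2 - 1)) (laguerreL ((d : ℝ) / 2 - 1)) α g := by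
  simp only [IsL2Expansion, eLpNorm_sub_sum_eq_enorm (coeFn_laguerreVec hd),
    eLpNorm_sub_sum_eq_enorm (lensOperator_laguerreVec hd hJ), ← map_smul, ← map_sum] at hf ⊢
  have hpos : (0 : ℝ) < 2 ^ (-((d : ℝ) / 4)) := by positivity
  have hanti : AntilipschitzWith (Real.toNNReal (2 ^ (-((d : ℝ) / 4)))⁻¹) J :=
    J.antilipschitz_of_bound fun x => by
      rw [norm_lensOperator hd hJ, Real.coe_toNNReal _ (by positivity),
        inv_mul_cancel_left₀ hpos.ne']
  have hclosed : IsClosed (Set.range J) := hanti.isClosed_range J.uniformContinuous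
  have hlim : Tendsto (fun N => J (∑ n ∈ Finset.range N, α n • laguerreVec hd n)) atTop (𝓝 f) := by
    rw [tendsto_iff_edist_tendsto_0]
    simpa only [edist_comm, edist_eq_enorm_sub] using hf
  obtain ⟨g, hg⟩ := hclosed.mem_of_tendsto hlim (Eventually.of_forall fun N => ⟨_, rfl⟩)
  refine ⟨g, hg, ?_⟩
  simp only [← hg, ← map_sub, enorm_lensOperator hd hJ] at hf
  have h := ENNReal.Tendsto.const_mul (a := (ENNReal.ofReal (2 ^ (-((d : ℝ) / 4))))⁻¹) hf
    (Or.inr (ENNReal.inv_ne_top.2 (by simpa using hpos)))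
  simpa only [← mul_assoc, ENNReal.inv_mul_cancel (ne_of_gt (ENNReal.ofReal_pos.2 hpos))
    ENNReal.ofReal_ne_top, one_mul, mul_zero] using h

/-! ### The change of time variable and the norm identities -/

theorem cexp_neg_two_arctan (s : ℝ) :
    Complex.exp (2 * Real.pi * Complex.I * ((-(Real.arctan s / Real.pi) : ℝ) : ℂ)) =
      (1 - s * Complex.I) / (1 + s * Complex.I) := by
  have hpi : (Real.pi : ℂ) ≠ 0 := by exact_mod_cast Real.pi_ne_zero
  have e : (2 * Real.pi * Complex.I * ((-(Real.arctan s / Real.pi) : ℝ) : ℂ)) =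
      ((2 : ℕ) : ℂ) * (((-Real.arctan s : ℝ) : ℂ) * Complex.I) := by
    push_cast; field_simp
  rw [e, Complex.exp_nat_mul, Complex.exp_mul_I, ← Complex.ofReal_cos, ← Complex.ofReal_sin,
    Real.cos_neg, Real.sin_neg, Real.cos_arctan, Real.sin_arctan]
  have hs : (0 : ℝ) < 1 + s ^ 2 := by positivity
  have hr : ((√(1 + s ^ 2) : ℝ) : ℂ) ^ 2 = 1 + s ^ 2 := by
    rw [← Complex.ofReal_pow, Real.sq_sqrt hs.le]; push_cast; ring
  have hr0 : ((√(1 + s ^ 2) : ℝ) : ℂ) ≠ 0 := by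
    exact_mod_cast (Real.sqrt_pos.2 hs).ne'
  have ha0 : (1 + s * Complex.I : ℂ) ≠ 0 := by
    intro h; simpa using congrArg Complex.re h
  push_cast
  field_simp
  rw [hr]
  linear_combination (1 - s * Complex.I) * (-(s : ℂ) ^ 2) * Complex.I_sq

/-- The substitution is injective with Jacobian `4/(1+(4πt)²)`, and the endpoints are null. Since
`H` is arbitrary, no measurability in time of the family `𝓛` is ever required. -/
theorem lintegral_comp_arctan (H : ℝ → ENNReal) :
    ∫⁻ t : ℝ, ENNReal.ofReal (4 / (1 + (4 * Real.pi * t) ^ 2)) *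
        H (-(Real.arctan (4 * Real.pi * t) / Real.pi)) =
      ∫⁻ τ in Set.Icc (-(1 / 2) : ℝ) (1 / 2), H τ := by
  have himg : (fun t : ℝ => -(Real.arctan (4 * Real.pi * t) / Real.pi)) '' Set.univ =
      Set.Ioo (-(1 / 2) : ℝ) (1 / 2) := by
    ext τ
    simp only [Set.image_univ, Set.mem_range, Set.mem_Ioo]
    have hpi := Real.pi_pos
    constructor
    · rintro ⟨t, rfl⟩
      have h1 := Real.arctan_lt_pi_div_two (4 * Real.pi * t)
      have h2 := Real.neg_pi_div_two_lt_arctan (4 * Real.pi * t)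
      constructor
      · rw [neg_lt_neg_iff, div_lt_iff₀ hpi]; linarith
      · rw [neg_lt, lt_div_iff₀ hpi]; linarith
    · rintro ⟨h1, h2⟩
      refine ⟨Real.tan (-(Real.pi * τ)) / (4 * Real.pi), ?_⟩
      rw [mul_div_cancel₀ _ (by positivity), Real.arctan_tan]
      · field_simp
      · nlinarith
      · nlinarith
  have h := lintegral_image_eq_lintegral_abs_deriv_mul
    (f := fun t : ℝ => -(Real.arctan (4 * Real.pi * t) / Real.pi))
    (f' := fun t => -((1 / (1 + (4 * Real.pi * t) ^ 2) * (4 * Real.pi)) / Real.pi))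
    MeasurableSet.univ (fun t _ => by
      have h1 : HasDerivAt (fun t : ℝ => 4 * Real.pi * t) (4 * Real.pi) t := by
        simpa using (hasDerivAt_id t).const_mul (4 * Real.pi)
      exact ((h1.arctan.div_const Real.pi).neg).hasDerivWithinAt)
    (fun t _ t' _ ht => by
      have h1 : Real.arctan (4 * Real.pi * t) = Real.arctan (4 * Real.pi * t') := by
        have := neg_injective ht
        exact (div_left_inj' Real.pi_ne_zero).1 this
      exact mul_left_cancel₀ (by positivity) (Real.arctan_injective h1)) H
  rw [himg, setLIntegral_univ] at h
  rw [← Measure.restrict_congr_set Ioo_ae_eq_Icc, h]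
  refine lintegral_congr fun t => ?_
  congr 2
  rw [abs_neg, abs_of_nonneg (by positivity)]
  have := Real.pi_ne_zero
  field_simp

theorem eLpNorm_schrodinger_rpow {d : ℕ} (hd : 1 ≤ d) {p q : ℝ} (hp : 2 ≤ p) (hq : 2 ≤ q)
    (hpq : (d : ℝ) / p + 2 / q = (d : ℝ) / 2)
    {J : LaguerreL2 ((d : ℝ) / 2 - 1) →L[ℂ] SpaceL2 d}
    (hJ : ∀ h, J h =ᵐ[volume]
      fun x => lensWeight d 0 x * h (2 * Real.pi / (1 + 0 ^ 2) * ‖x‖ ^ 2))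
    {𝓛 : ℝ → (LaguerreL2 ((d : ℝ) / 2 - 1) →L[ℂ] LaguerreL2 ((d : ℝ) / 2 - 1))}
    (h𝓛 : ∀ t : ℝ, IsLaguerreOperator ((d : ℝ) / 2 - 1) p t (𝓛 t))
    (g : LaguerreL2 ((d : ℝ) / 2 - 1)) (t : ℝ) :
    eLpNorm (schrodinger t (J g)) (ENNReal.ofReal p) volume ^ q =
      ENNReal.ofReal (p ^ (-((d : ℝ) * q / (2 * p))) / 4) *
      (ENNReal.ofReal (4 / (1 + (4 * Real.pi * t) ^ 2)) *
        (∫⁻ x, ‖𝓛 (-(Real.arctan (4 * Real.pi * t) / Real.pi)) g x‖ₑ ^ p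
          ∂laguerreMeasure ((d : ℝ) / 2 - 1)) ^ (q / p)) := by
  have hp0 : 0 < p := by linarith
  have hq0 : 0 < q := by linarith
  set s : ℝ := 4 * Real.pi * t with hs
  set τ : ℝ := -(Real.arctan s / Real.pi) with hτ
  obtain ⟨D, hD⟩ := exists_dilation hd (c := 2 / p) (by positivity) ((div_le_one hp0).2 hp)
  obtain ⟨M, hM⟩ := exists_phaseOperator hd (norm_cexp_two_pi_I_mul τ)
  obtain ⟨W, hW⟩ := exists_lensOperator hd s
  have h𝓛τ : 𝓛 τ = D ∘L M :=
    (h𝓛 τ).unique hd (isLaguerreOperator_dilation_comp hd hD hM)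
  rw [hτ, cexp_neg_two_arctan] at hM
  rw [schrodinger_lensOperator hd hs hJ hW hM, eLpNorm_congr_ae (hW (M g)),
    eLpNorm_eq_lintegral_rpow_enorm_toReal (by simpa using hp0) (by simp),
    ENNReal.toReal_ofReal hp0.le,
    lintegral_lensWeight_mul hd s hp0 (Lp.stronglyMeasurable (M g)).measurable]
  have hint : ∫⁻ x, ‖𝓛 τ g x‖ₑ ^ p ∂laguerreMeasure ((d : ℝ) / 2 - 1) =
      ∫⁻ x, ‖M g (2 / p * x)‖ₑ ^ p ∂laguerreMeasure ((d : ℝ) / 2 - 1) := by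
    refine lintegral_congr_ae ?_
    rw [h𝓛τ]
    filter_upwards [hD.1 (M g)] with x hx
    rw [ContinuousLinearMap.comp_apply, hx]
  rw [hint, ← ENNReal.rpow_mul, one_div_mul_eq_div,
    ENNReal.mul_rpow_of_nonneg _ _ (by positivity),
    ENNReal.ofReal_rpow_of_nonneg (by positivity) (by positivity), ← mul_assoc,
    ← ENNReal.ofReal_mul (by positivity)]
  congr 2
  have hs2 : (0 : ℝ) < 1 + s ^ 2 := by positivity
  -- Admissibility enters here: the surviving power of `1 + s²` is exactly the one in the Jacobian.
  have e1 : ((d : ℝ) / 2 - d * p / 4) * (q / p) = -1 := by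
    field_simp at hpq ⊢
    linarith
  rw [Real.mul_rpow (by positivity) (by positivity), ← Real.rpow_mul hs2.le, e1,
    ← Real.rpow_mul hp0.le, Real.rpow_neg_one,
    show -((d : ℝ) / 2) * (q / p) = -(d * q / (2 * p)) by field_simp]
  field_simp

theorem mainTheorem7 (d : ℕ) (hd : 1 ≤ d) (ν : ℝ) (hν : ν = (d : ℝ) / 2 - 1)
    (p q : ℝ) (hp : 2 ≤ p) (hq : 2 ≤ q) (hpq : (d : ℝ) / p + 2 / q = (d : ℝ) / 2) :
    (∀ t : ℝ, ∃! T : LaguerreL2 ν →L[ℂ] LaguerreL2 ν, IsLaguerreOperator ν p t T) ∧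
    ∀ (f : SpaceL2 d) (α : ℕ → ℂ), IsRadial f →
      IsL2Expansion volume (radialPsi d) α f →
      ∃ g : LaguerreL2 ν, IsL2Expansion (laguerreMeasure ν) (laguerreL ν) α g ∧
        (∀ 𝓛 : ℝ → (LaguerreL2 ν →L[ℂ] LaguerreL2 ν),
          (∀ t : ℝ, IsLaguerreOperator ν p t (𝓛 t)) →
          strichartzNorm p q f / ENNReal.ofReal (normalizingFactor p d) =
            (∫⁻ t in Set.Icc (-(1 / 2) : ℝ) (1 / 2),
              (∫⁻ x, ‖𝓛 t g x‖ₑ ^ p ∂laguerreMeasure ν) ^ (q / p)) ^ (1 / q)) ∧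
        sharpConst p d / normalizingFactor p d * ‖f‖ = ‖g‖ := by
  subst hν
  have hp0 : 0 < p := by linarith
  have hq0 : 0 < q := by linarith
  refine ⟨fun t => ?_, fun f α _ hf => ?_⟩
  · obtain ⟨D, hD⟩ := exists_dilation hd (c := 2 / p) (by positivity) ((div_le_one hp0).2 hp)
    obtain ⟨M, hM⟩ := exists_phaseOperator hd (norm_cexp_two_pi_I_mul t)
    have hT := isLaguerreOperator_dilation_comp hd hD hM
    exact ⟨D ∘L M, hT, fun T' hT' => IsLaguerreOperator.unique hd hT' hT⟩
  · obtain ⟨J, hJ⟩ := exists_lensOperator hd 0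
    obtain ⟨g, rfl, hg⟩ := exists_isL2Expansion_laguerreL hd hJ hf
    -- By admissibility `d(1/p - 1/2) = -2/q`, so the power of `2` equals `4^{-1/q}`, which absorbs
    -- the `4` of the Jacobian.
    have hnf : normalizingFactor p d = (p ^ (-((d : ℝ) * q / (2 * p))) / 4) ^ (1 / q) := by
      have e : (1 / p - 1 / 2) * (d : ℝ) = -(2 * (1 / q)) := by
        have : (1 / p - 1 / 2) * (d : ℝ) = d / p - d / 2 := by ring
        rw [this, ← hpq]; ring
      have h1 : (p ^ (-(1 / (2 * p)))) ^ d = (p ^ (-((d : ℝ) * q / (2 * p)))) ^ (1 / q) := by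
        rw [← Real.rpow_natCast, ← Real.rpow_mul hp0.le, ← Real.rpow_mul hp0.le]
        congr 1; field_simp
      have h2 : ((2 : ℝ) ^ (1 / p - 1 / 2)) ^ d = (4 ^ (1 / q))⁻¹ := by
        rw [← Real.rpow_natCast, ← Real.rpow_mul (by norm_num), e, Real.rpow_neg (by norm_num),
          Real.rpow_mul (by norm_num)]
        norm_num
      rw [normalizingFactor, mul_pow, h1, h2, Real.div_rpow (by positivity) (by norm_num)]
      exact (div_eq_mul_inv _ _).symm
    refine ⟨g, hg, fun 𝓛 h𝓛 => ?_, ?_⟩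
    · have hnf0 : 0 < normalizingFactor p d := by rw [normalizingFactor]; positivity
      rw [strichartzNorm, eLpNorm_eq_lintegral_rpow_enorm_toReal (by simpa using hq0) (by simp),
        ENNReal.toReal_ofReal hq0.le]
      simp only [enorm_eq_self, eLpNorm_schrodinger_rpow hd hp hq hpq hJ h𝓛]
      rw [lintegral_const_mul' _ _ ENNReal.ofReal_ne_top,
        lintegral_comp_arctan fun τ => (∫⁻ x, ‖𝓛 τ g x‖ₑ ^ p
          ∂laguerreMeasure ((d : ℝ) / 2 - 1)) ^ (q / p),
        ENNReal.mul_rpow_of_nonneg _ _ (by positivity),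
        ENNReal.ofReal_rpow_of_nonneg (by positivity) (by positivity), ← hnf, mul_comm,
        ENNReal.mul_div_cancel_right (by simpa using hnf0) ENNReal.ofReal_ne_top]
    · rw [norm_lensOperator hd hJ, sharpConst, normalizingFactor, ← div_pow,
        mul_div_mul_left _ _ (by positivity), ← Real.rpow_sub (by norm_num),
        ← Real.rpow_natCast, ← Real.rpow_mul (by norm_num), ← mul_assoc,
        ← Real.rpow_add (by norm_num),
        show (1 / p - 1 / 4 - (1 / p - 1 / 2)) * (d : ℝ) + -((d : ℝ) / 4) = 0 by ring,
        Real.rpow_zero, one_mul]
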